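/- For $S\subset[0,2\pi]$ let $|S|$ denote its normalized Lebesgue measure, i.e. Lebesgue measure divided by $2\pi$. Let $PW_S$ be the space of all $f\in L^2(\mathbb R)$ whose Fourier transform $\hat f(t)=\frac1{2\pi}\int_{\mathbb R}e^{-ixt}f(x)\,dx$ (understood in the $L^2$ sense) vanishes almost everywhere outside $S$, where each $f$ is identified with its continuous representative, and let $\|f\|$ be the $L^2(\mathbb R)$-norm. For $\Lambda\subset\mathbb Z$ put $D^{\sharp}(\Lambda)=\lim_{n\to\infty}\frac{|\Lambda\cap[-n,n]|}{2n}$, provided the limit exists. **Theorem.** For every $d>0$ there is a constant $C(d)>0$, depending only on $d$, such that for every Lebesgue measurable set $S\subset[0,2\pi]$ of positive measure there is a set $\Lambda\subset\mathbb Z$ for which the limit $D^{\sharp}(\Lambda)$ exists, $D^{\sharp}(\Lambda)<(1+d)|S|$, and $$C(d)\,|S|\,\|f\|^2\le\sum_{\lambda\in\Lambda}|f(\lambda)|^2<\infty\qquad\text{for all } f\in PW_S .$$ -/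

import Mathlib

open MeasureTheory Filter Topology

open scoped FourierTransform

noncomputable section

/-- The Fourier transform on `L²(ℝ)` normalized as
`f̂(t) = (1 / 2π) ∫ e^{-ixt} f(x) dx`. It is obtained by rescaling Mathlib's `L²` Fourier transform
`𝓕 f (ξ) = ∫ e^{-2πixξ} f(x) dx`. -/
def fourierHat (f : Lp ℂ 2 (volume : Measure ℝ)) (t : ℝ) : ℂ :=
  (1 / (2 * Real.pi) : ℂ) * (𝓕 f : Lp ℂ 2 (volume : Measure ℝ)) (t / (2 * Real.pi))

/-- `f` belongs to the Paley-Wiener space `PW_S`: it is square integrable on `ℝ` and its Fourier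
transform vanishes almost everywhere off `S`. As the values of `f` at single points matter, `f`
is the continuous representative of its class in `L²`. -/
def MemPaleyWiener (S : Set ℝ) (f : ℝ → ℂ) : Prop :=
  Continuous f ∧
    ∃ hf : MemLp f 2 (volume : Measure ℝ), ∀ᵐ t ∂(volume : Measure ℝ),
      t ∉ S → fourierHat (hf.toLp f) t = 0

/-- `|S|`: the Lebesgue measure on `[0, 2π]`, normalized to have total mass one. -/
def normalizedMeasure (S : Set ℝ) : ℝ :=
  (volume : Measure ℝ).real S / (2 * Real.pi)

/-- The limit `D♯(Λ) = lim_n |Λ ∩ [-n, n]| / (2n)` exists and equals `D`. -/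
def HasSymmetricDensity (Λ : Set ℤ) (D : ℝ) : Prop :=
  Tendsto (fun n : ℕ => ((Λ ∩ Set.Icc (-(n : ℤ)) (n : ℤ)).ncard : ℝ) / (2 * (n : ℝ)))
    atTop (𝓝 D)

end

/-!
The theorem follows from a finite-dimensional selection result, made uniform along the integers by
a compactness argument.

*Selection.* Let `v₁, …, v_m` in `ℂᵏ` satisfy `∑ v_j v_j⋆ = 1`, and let `0 < e ≤ 1`. Given
`N ≥ (1 + e) k`, one can select at most `N` of the vectors, without repetition or weights, so that
`∑ |⟨v_j, x⟩|² ≥ (e² / 16) (k / m) ‖x‖²` (`exists_subset_frame_lower_bound`). The proof is a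
one-sided version of the barrier method of Batson, Spielman and Srivastava. With `A` the sum of
the `v_j v_j⋆` selected so far, one keeps `tr (A - l)⁻¹ ≤ Φ₀` while `l` moves up by a fixed amount
at each step. The vectors not yet selected satisfy `∑ v_j v_j⋆ = 1 - A` exactly, so averaging over
them produces a vector that can be selected next, and no upper barrier is needed to control the
weights (`barrier_scalar`, `barrier_step`).

*Periodic sampling sets.* Rescale frequencies to `[0, 1]`. For functions whose Fourier transform
lives on a union of `k` of the `m` intervals `(s / m, (s + 1) / m]`, Parseval's identity on
`(0, 1 / m]` turns sampling on a union of residue classes modulo `m` into the frame inequality for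
the rows of the discrete Fourier matrix (`exists_periodic_isSampling`). A compact set is contained
in such a union of nearly the same measure.

*General spectra and density.* Call a subset of `ℤ` good if sampling on it has the required lower
bound for the given spectrum `E`. Since the samples of a function on all of `ℤ` are square summable,
the good sets form a closed, hence compact, shift-invariant family in `{0, 1}^ℤ`. Exhausting `E` by
compact sets and passing to a limit gives good sets with at most `(1 + 5 e) |E| T` elements in the
window `[0, T)`, for every `T` (`exists_isSampling_windowCount_le`); the limit keeps the sampling
bound but not the density, as periods are unbounded. To recover it, let `α` be the least density of
long windows over the whole family. Every window of every good set has density at least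
`α - o(1)`, so a good set that is as sparse as possible in a long window has few points in that
window from which the average to the right or to the left over a long
window exceeds `α` by a definite amount
(`windowCount_ge_of_heavy`, a maximal inequality). Translating to a point with no such excess and
passing to the limit once more gives a good set of density exactly `α`
(`exists_mem_hasSymmetricDensity`).
-/

/-! ### Selecting a subset of a Parseval frame -/

/-- The averaging step of the barrier argument, in terms of the eigenvalues `x i` of `A - l`, where
`l` is the new barrier and `l - δ` the old one. The number `c j i` is the squared modulus of the
component of the `j`-th remaining vector along the `i`-th eigenvector. The conclusion says that
adding the rank one matrix of some remaining vector brings the trace of `(A - l)⁻¹` back to at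
most `Φ₀`. -/
theorem barrier_scalar {ι κ : Type*} [Fintype κ] [Nonempty κ] (R : Finset ι) (c : ι → κ → ℝ)
    (x : κ → ℝ) (δ l Φ₀ m : ℝ) (hx : ∀ i, 0 < x i) (hδ : 0 < δ) (hΦ₀ : 0 < Φ₀) (hl : l ≤ 1)
    (hsum : ∀ i, ∑ j ∈ R, c j i = 1 - l - x i)
    (hold : ∑ i, 1 / (x i + δ) ≤ Φ₀) (hnew : Φ₀ < ∑ i, 1 / x i)
    (hδΦ : δ * Φ₀ ≤ 1) (hR : (R.card : ℝ) ≤ m)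
    (hm : δ * m ≤ (1 - l) * (1 - δ * Φ₀) - Fintype.card κ / Φ₀) :
    ∃ j ∈ R, (∑ i, 1 / x i - Φ₀) * (1 + ∑ i, c j i / x i) ≤ ∑ i, c j i / x i ^ 2 := by
  by_contra! hcon
  set Φ := ∑ i, 1 / (x i + δ) with hΦ
  set Φ' := ∑ i, 1 / x i with hΦ'
  set τ := ∑ i, 1 / (x i * (x i + δ)) with hτ
  set S := ∑ i, 1 / x i ^ 2 with hS
  set S3 := ∑ i, 1 / (x i ^ 2 * (x i + δ)) with hS3
  set k : ℝ := (Fintype.card κ : ℝ) with hk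
  have hxδ : ∀ i, 0 < x i + δ := fun i => by linarith [hx i]
  have hk1 : 1 ≤ k := by rw [hk]; exact_mod_cast Fintype.card_pos
  have hΦpos : 0 < Φ := Finset.sum_pos (fun i _ => by have := hxδ i; positivity)
    Finset.univ_nonempty
  have hτpos : 0 < τ := Finset.sum_pos (fun i _ => by have := hxδ i; have := hx i; positivity)
    Finset.univ_nonempty
  have h1 : Φ' = Φ + δ * τ := by
    rw [hΦ, hΦ', hτ, Finset.mul_sum, ← Finset.sum_add_distrib]
    refine Finset.sum_congr rfl fun i _ => ?_
    have := hxδ i; have := hx i; field_simp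
  have h2 : S = τ + δ * S3 := by
    rw [hS, hS3, hτ, Finset.mul_sum, ← Finset.sum_add_distrib]
    refine Finset.sum_congr rfl fun i _ => ?_
    have := hxδ i; have := hx i; field_simp
  -- Cauchy-Schwarz inequality
  have h3 : τ ^ 2 ≤ S3 * Φ := by
    refine Finset.sum_sq_le_sum_mul_sum_of_sq_le_mul _ (fun i _ => ?_) (fun i _ => ?_)
      (fun i _ => ?_)
    · have := hxδ i; have := hx i; positivity
    · have := hxδ i; positivity
    · have := hxδ i; have := hx i; apply le_of_eq; field_simp
  -- Chebyshev's sum inequality for two functions decreasing in `x i`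
  have h4 : Φ' * Φ ≤ k * τ := by
    have hmono : Monovary (fun i => 1 / x i) (fun i => 1 / (x i + δ)) := by
      intro i j hij
      have := hxδ i; have := hx i; have := hxδ j; have := hx j
      simp only at hij ⊢
      rw [one_div_lt_one_div (by assumption) (by assumption)] at hij
      exact one_div_le_one_div_of_le (by assumption) (by linarith)
    have := hmono.sum_mul_sum_le_card_mul_sum
    simpa [hτ, hk, hΦ, hΦ', mul_comm] using this
  have hΦ'pos : 0 < Φ' := hΦ₀.trans hnew
  have h5 : Φ' < τ * (k / Φ₀ + δ) := by
    have hlt : k / Φ' < k / Φ₀ := by gcongr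
    have : Φ' * Φ' ≤ Φ' * (τ * (k / Φ' + δ)) := by
      have e : Φ' * (τ * (k / Φ' + δ)) = k * τ + Φ' * (δ * τ) := by field_simp
      rw [e]
      have : Φ' * Φ' = Φ' * Φ + Φ' * (δ * τ) := by nth_rw 2 [h1]; ring
      linarith
    have := le_of_mul_le_mul_left this hΦ'pos
    have h6 : τ * (k / Φ' + δ) < τ * (k / Φ₀ + δ) := by gcongr
    linarith
  have h7 : τ + δ * τ * (δ * τ) ≤ S := by
    have : δ * (δ * τ ^ 2) ≤ δ * S3 := by
      have hS30 : 0 ≤ S3 := Finset.sum_nonneg fun i _ => by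
        have := hxδ i; have := hx i; positivity
      have : δ * Φ ≤ 1 := le_trans (by gcongr) hδΦ
      have h8 : δ * τ ^ 2 ≤ δ * (S3 * Φ) := by gcongr
      have h9 : S3 * (δ * Φ) ≤ S3 * 1 := by gcongr
      gcongr
      linarith
    rw [h2]; linarith
  -- averaging over the remaining indices
  have hg : ∑ j ∈ R, ∑ i, c j i / x i = (1 - l) * Φ' - k := by
    rw [Finset.sum_comm]
    simp_rw [← Finset.sum_div, hsum, sub_div, Finset.sum_sub_distrib]
    have : ∑ i, x i / x i = k := by simp [hk, fun i => div_self (hx i).ne']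
    rw [this, hΦ', Finset.mul_sum, ← Finset.sum_sub_distrib]
    congr 1
    exact Finset.sum_congr rfl fun i _ => by have := hx i; field_simp
  have hf : ∑ j ∈ R, ∑ i, c j i / x i ^ 2 = (1 - l) * S - Φ' := by
    rw [Finset.sum_comm]
    simp_rw [← Finset.sum_div, hsum]
    rw [hS, hΦ', Finset.mul_sum, ← Finset.sum_sub_distrib]
    exact Finset.sum_congr rfl fun i _ => by have := hx i; field_simp
  have hle : (1 - l) * S - Φ' ≤ (Φ' - Φ₀) * (R.card + ((1 - l) * Φ' - k)) := by
    rw [← hf, ← hg]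
    have : (Φ' - Φ₀) * (R.card + ∑ j ∈ R, ∑ i, c j i / x i)
        = ∑ j ∈ R, (Φ' - Φ₀) * (1 + ∑ i, c j i / x i) := by
      rw [← Finset.mul_sum, Finset.sum_add_distrib]; simp
    rw [this]
    exact Finset.sum_le_sum fun j hj => (hcon j hj).le
  have hl' : 0 ≤ 1 - l := by linarith
  have hB : (Φ' - Φ₀) * (R.card + ((1 - l) * Φ' - k)) ≤
      δ * τ * (m - k + (1 - l) * Φ') := by
    have h10 : 0 ≤ m - k + (1 - l) * Φ' → (Φ' - Φ₀) * (R.card + ((1 - l) * Φ' - k)) ≤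
      δ * τ * (m - k + (1 - l) * Φ') := by
      intro h
      have a1 : (Φ' - Φ₀) * (R.card + ((1 - l) * Φ' - k)) ≤ (Φ' - Φ₀) * (m - k + (1 - l) * Φ') :=
        mul_le_mul_of_nonneg_left (by linarith) (by linarith)
      have a2 : (Φ' - Φ₀) * (m - k + (1 - l) * Φ') ≤ δ * τ * (m - k + (1 - l) * Φ') :=
        mul_le_mul_of_nonneg_right (by linarith) h
      linarith
    apply h10
    have hm0 : (0:ℝ) ≤ m := le_trans (by positivity) hR
    -- `k / Φ₀ ≤ 1 - l`
    have h11 : k / Φ₀ ≤ 1 - l := by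
      have : 0 ≤ δ * m := by positivity
      have : (1 - l) * (1 - δ * Φ₀) ≤ 1 - l := by
        have := mul_nonneg hl' (mul_nonneg hδ.le hΦ₀.le)
        linarith
      linarith
    have : k ≤ (1 - l) * Φ' := by
      rw [div_le_iff₀ hΦ₀] at h11
      exact h11.trans (by gcongr)
    linarith
  have hC : (1 - l) * (τ + δ * τ * (δ * τ)) ≤ (1 - l) * S := by gcongr
  have hD : (1 - l) * (1 - δ * Φ₀) ≤ (1 - l) * (1 - δ * Φ) := by gcongr
  have hE : τ * (δ * m) ≤ τ * ((1 - l) * (1 - δ * Φ) - k / Φ₀) := by gcongr; linarith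
  have hF : τ * δ ≤ τ * δ * k := by nlinarith [mul_pos hτpos hδ]
  rw [h1] at hle hB h5
  nlinarith
/-- The trace of the Sherman-Morrison formula. -/
theorem trace_inv_add_vecMulVec {κ : Type*} [Fintype κ] [DecidableEq κ] (B M : Matrix κ κ ℂ)
    (hBM : B * M = 1) (v : κ → ℂ) (h : 1 + star v ⬝ᵥ M.mulVec v ≠ 0) :
    ((B + Matrix.vecMulVec v (star v))⁻¹).trace =
      M.trace - (star v ⬝ᵥ (M * M).mulVec v) / (1 + star v ⬝ᵥ M.mulVec v) := by
  set q := star v ⬝ᵥ M.mulVec v with hq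
  have hinv : (B + Matrix.vecMulVec v (star v))⁻¹ =
      M - (1 + q)⁻¹ • Matrix.vecMulVec (M.mulVec v) (Matrix.vecMul (star v) M) := by
    apply Matrix.inv_eq_right_inv
    rw [mul_sub, add_mul, hBM, Matrix.mul_smul, add_mul, Matrix.mul_vecMulVec,
      Matrix.vecMulVec_mul, Matrix.vecMulVec_mul_vecMulVec, Matrix.mulVec_mulVec, hBM,
      Matrix.one_mulVec, ← hq]
    rw [Matrix.vecMulVec_smul]
    have e : ∀ P : Matrix κ κ ℂ, (1 + q)⁻¹ • (P + q • P) = P := fun P => by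
      nth_rw 1 [← one_smul ℂ P]
      rw [← add_smul, smul_smul, inv_mul_cancel₀ h, one_smul]
    rw [e]
    abel
  rw [hinv, Matrix.trace_sub, Matrix.trace_smul, Matrix.trace_vecMulVec, ← Matrix.mulVec_mulVec,
    Matrix.dotProduct_mulVec (star v) M, dotProduct_comm, smul_eq_mul]
  ring

/-- The Hermitian matrix with eigenvalues `f i` and eigenvectors the columns of `U`. -/
def conjDiagonal {κ : Type*} [Fintype κ] [DecidableEq κ] (U : Matrix κ κ ℂ) (f : κ → ℝ) :
    Matrix κ κ ℂ :=
  U * Matrix.diagonal (fun i => (f i : ℂ)) * star U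

section
open scoped ComplexOrder
variable {κ : Type*} [Fintype κ] [DecidableEq κ] {U : Matrix κ κ ℂ}

theorem conjDiagonal_mul (hU : star U * U = 1) (f g : κ → ℝ) :
    conjDiagonal U f * conjDiagonal U g = conjDiagonal U (fun i => f i * g i) := by
  have : conjDiagonal U f * conjDiagonal U g = U * Matrix.diagonal (fun i => (f i : ℂ)) *
      (star U * U) * Matrix.diagonal (fun i => (g i : ℂ)) * star U := by
    simp only [conjDiagonal, mul_assoc]
  rw [this, hU, mul_one, mul_assoc U, Matrix.diagonal_mul_diagonal]
  simp [conjDiagonal]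

theorem trace_conjDiagonal (hU : star U * U = 1) (f : κ → ℝ) :
    (conjDiagonal U f).trace = ((∑ i, f i : ℝ) : ℂ) := by
  rw [conjDiagonal, Matrix.trace_mul_cycle, hU, one_mul, Matrix.trace_diagonal]
  simp

theorem star_dotProduct_conjDiagonal (f : κ → ℝ) (v : κ → ℂ) :
    star v ⬝ᵥ (conjDiagonal U f).mulVec v =
      ((∑ i, f i * ‖(star U).mulVec v i‖ ^ 2 : ℝ) : ℂ) := by
  rw [conjDiagonal, mul_assoc, ← Matrix.mulVec_mulVec, Matrix.dotProduct_mulVec,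
    ← Matrix.mulVec_mulVec]
  have : Matrix.vecMul (star v) U = star ((star U).mulVec v) := by
    rw [Matrix.star_mulVec, Matrix.star_eq_conjTranspose, Matrix.conjTranspose_conjTranspose]
  rw [this]
  simp only [dotProduct, Matrix.mulVec_diagonal, Pi.star_apply]
  push_cast
  refine Finset.sum_congr rfl fun i _ => ?_
  rw [← Complex.conj_mul']
  simp only [RCLike.star_def]
  ring

theorem conjDiagonal_const (hU : U * star U = 1) (a : ℝ) :
    conjDiagonal U (fun _ => a) = (a : ℂ) • (1 : Matrix κ κ ℂ) := by
  have : Matrix.diagonal (fun _ : κ => (a : ℂ)) = (a : ℂ) • (1 : Matrix κ κ ℂ) := by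
    rw [Matrix.smul_one_eq_diagonal]
  rw [conjDiagonal, this, Matrix.mul_smul, mul_one, Matrix.smul_mul, hU]

theorem conjDiagonal_sub (f g : κ → ℝ) :
    conjDiagonal U f - conjDiagonal U g = conjDiagonal U (fun i => f i - g i) := by
  simp only [conjDiagonal, ← sub_mul, ← mul_sub, Matrix.diagonal_sub]
  simp

theorem inv_conjDiagonal (hU : star U * U = 1) (f : κ → ℝ) (hf : ∀ i, f i ≠ 0) :
    conjDiagonal U f * conjDiagonal U (fun i => 1 / f i) = 1 := by
  have hU' : U * star U = 1 := mul_eq_one_comm.mp hU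
  rw [conjDiagonal_mul hU]
  have : (fun i => f i * (1 / f i)) = fun _ => (1 : ℝ) := by
    ext i; have := hf i; field_simp
  rw [this, conjDiagonal_const hU']; simp

theorem posDef_conjDiagonal_iff (hU : star U * U = 1) (f : κ → ℝ) :
    (conjDiagonal U f).PosDef ↔ ∀ i, 0 < f i := by
  have hU' : U * star U = 1 := mul_eq_one_comm.mp hU
  have : IsUnit U := ⟨⟨U, star U, hU', hU⟩, rfl⟩
  rw [conjDiagonal, Matrix.IsUnit.posDef_star_right_conjugate_iff this,
    Matrix.posDef_diagonal_iff]
  simp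

/-- Moving the barrier from `l` to `l + δ` while keeping the potential `tr (A - l)⁻¹` at most `Φ₀`,
at the price of selecting at most one of the remaining vectors. -/
theorem barrier_step {ι : Type*} [Nonempty κ] (v : ι → κ → ℂ) (R : Finset ι) (A : Matrix κ κ ℂ)
    (hA : A.IsHermitian) (hsum : ∑ j ∈ R, Matrix.vecMulVec (v j) (star (v j)) = 1 - A)
    (l δ Φ₀ m : ℝ) (hδ : 0 < δ) (hΦ₀ : 0 < Φ₀) (hl : l + δ ≤ 1) (hδΦ : δ * Φ₀ < 1)
    (hR : (R.card : ℝ) ≤ m)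
    (hm : δ * m ≤ (1 - (l + δ)) * (1 - δ * Φ₀) - Fintype.card κ / Φ₀)
    (hpd : (A - (l : ℂ) • (1 : Matrix κ κ ℂ)).PosDef)
    (hpot : ((A - (l : ℂ) • (1 : Matrix κ κ ℂ))⁻¹).trace.re ≤ Φ₀) :
    (A - ((l + δ : ℝ) : ℂ) • (1 : Matrix κ κ ℂ)).PosDef ∧
      (((A - ((l + δ : ℝ) : ℂ) • (1 : Matrix κ κ ℂ))⁻¹).trace.re ≤ Φ₀ ∨
      ∃ j ∈ R, ((A + Matrix.vecMulVec (v j) (star (v j)) -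
        ((l + δ : ℝ) : ℂ) • (1 : Matrix κ κ ℂ))⁻¹).trace.re ≤ Φ₀) := by
  obtain ⟨U, lam, hU, hU', rfl⟩ : ∃ (U : Matrix κ κ ℂ) (lam : κ → ℝ), star U * U = 1 ∧
      U * star U = 1 ∧ A = conjDiagonal U lam := by
    refine ⟨hA.eigenvectorUnitary, hA.eigenvalues, ?_, ?_, ?_⟩
    · simp
    · simp
    · conv_lhs => rw [hA.spectral_theorem, Unitary.conjStarAlgAut_apply]
      rfl
  have hsub : ∀ t : ℝ, conjDiagonal U lam - (t : ℂ) • (1 : Matrix κ κ ℂ) =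
      conjDiagonal U (fun i => lam i - t) := fun t => by
    rw [← conjDiagonal_const hU', conjDiagonal_sub]
  simp only [add_sub_right_comm]
  rw [hsub] at hpd hpot
  rw [hsub, posDef_conjDiagonal_iff hU]
  rw [posDef_conjDiagonal_iff hU] at hpd
  have hinv : ∀ f : κ → ℝ, (∀ i, f i ≠ 0) → ((conjDiagonal U f)⁻¹).trace.re = ∑ i, 1 / f i := by
    intro f hf
    rw [Matrix.inv_eq_right_inv (inv_conjDiagonal hU f hf), trace_conjDiagonal hU,
      Complex.ofReal_re]
  rw [hinv _ fun i => (hpd i).ne'] at hpot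
  have hx : ∀ i, 0 < lam i - (l + δ) := by
    intro i
    have h1 : 1 / (lam i - l) ≤ Φ₀ := le_trans
      (Finset.single_le_sum (f := fun i => 1 / (lam i - l))
        (fun j _ => (one_div_pos.mpr (hpd j)).le) (Finset.mem_univ i)) hpot
    have h2 := hpd i
    rw [div_le_iff₀ h2] at h1
    have : Φ₀ * δ < Φ₀ * (lam i - l) := by linarith
    have := lt_of_mul_lt_mul_left this hΦ₀.le
    linarith
  refine ⟨hx, ?_⟩
  rw [hinv _ fun i => (hx i).ne', or_iff_not_imp_left, not_le]
  intro hnew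
  have hcol : ∀ i, ∑ j ∈ R, ‖(star U).mulVec (v j) i‖ ^ 2 = 1 - (l + δ) - (lam i - (l + δ)) := by
    intro i
    -- the diagonal entries of `U⋆ (1 - A) U`
    have := congrArg (fun X => (star U * X * U) i i) hsum
    simp only [Finset.mul_sum, Finset.sum_mul, Matrix.sum_apply] at this
    have hr : (star U * (1 - conjDiagonal U lam) * U) i i = ((1 - lam i : ℝ) : ℂ) := by
      have e : star U * (1 - conjDiagonal U lam) * U = star U * U - (star U * U) *
        Matrix.diagonal (fun i => (lam i : ℂ)) * (star U * U) := by
        simp only [conjDiagonal]; noncomm_ring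
      rw [e, hU]; simp
    rw [hr] at this
    have e2 : ∀ j, (star U * Matrix.vecMulVec (v j) (star (v j)) * U) i i =
        ((‖(star U).mulVec (v j) i‖ ^ 2 : ℝ) : ℂ) := by
      intro j
      have : Matrix.vecMul (star (v j)) U = star ((star U).mulVec (v j)) := by
        rw [Matrix.star_mulVec, Matrix.star_eq_conjTranspose, Matrix.conjTranspose_conjTranspose]
      rw [Matrix.mul_vecMulVec, Matrix.vecMulVec_mul, this, Matrix.vecMulVec_apply]
      push_cast
      rw [← Complex.mul_conj']
      rfl
    simp only [e2] at this
    rw [← Complex.ofReal_sum] at this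
    have := Complex.ofReal_injective this
    linarith
  obtain ⟨j, hj, hle⟩ := barrier_scalar R (fun j i => ‖(star U).mulVec (v j) i‖ ^ 2)
    (fun i => lam i - (l + δ)) δ (l + δ) Φ₀ m hx hδ hΦ₀ hl hcol (by
      simpa only [sub_add_eq_sub_sub, sub_add_cancel] using hpot) hnew hδΦ.le hR hm
  refine ⟨j, hj, ?_⟩
  have hq := star_dotProduct_conjDiagonal (U := U) (fun i => 1 / (lam i - (l + δ))) (v j)
  have hq2 := star_dotProduct_conjDiagonal (U := U)
    (fun i => 1 / (lam i - (l + δ)) * (1 / (lam i - (l + δ)))) (v j)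
  set g := ∑ i, 1 / (lam i - (l + δ)) * ‖(star U).mulVec (v j) i‖ ^ 2 with hg
  have hg0 : 0 ≤ g := Finset.sum_nonneg fun i _ => by have := hx i; positivity
  rw [trace_inv_add_vecMulVec _ _ (inv_conjDiagonal hU _ fun i => (hx i).ne') (v j) (by
    rw [hq]; norm_cast; positivity), hq, trace_conjDiagonal hU, conjDiagonal_mul hU, hq2]
  norm_cast
  rw [sub_le_comm, le_div_iff₀ (by positivity)]
  have e1 : g = ∑ i, ‖(star U).mulVec (v j) i‖ ^ 2 / (lam i - (l + δ)) :=
    Finset.sum_congr rfl fun i _ => by ring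
  have e2 : ∑ i, 1 / (lam i - (l + δ)) * (1 / (lam i - (l + δ))) *
      ‖(star U).mulVec (v j) i‖ ^ 2 = ∑ i, ‖(star U).mulVec (v j) i‖ ^ 2 /
      (lam i - (l + δ)) ^ 2 := Finset.sum_congr rfl fun i _ => by
    have := hx i; field_simp
  rw [e1, e2]
  exact hle

/-- From a Parseval frame of `m` vectors in `ℂᵏ` one can select at most `N` vectors, for any
`N ≥ (1 + e) k`, whose lower frame bound is proportional to `k / m`, the average of the squared
norms of the frame vectors. -/
theorem exists_subset_frame_lower_bound {ι : Type*} [Fintype ι] [Nonempty κ]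
    (v : ι → κ → ℂ) (hv : ∑ j, Matrix.vecMulVec (v j) (star (v j)) = 1)
    (hcard : Fintype.card κ ≤ Fintype.card ι) (e : ℝ) (he : 0 < e) (he1 : e ≤ 1) (N : ℕ)
    (hN : (1 + e) * Fintype.card κ ≤ N) :
    ∃ J : Finset ι, J.card ≤ N ∧ ∀ x : κ → ℂ,
      e ^ 2 / 16 * (Fintype.card κ / Fintype.card ι) * ∑ i, ‖x i‖ ^ 2 ≤
        ∑ j ∈ J, ‖star (v j) ⬝ᵥ x‖ ^ 2 := by
  classical
  set k : ℝ := (Fintype.card κ : ℝ) with hk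
  set m : ℝ := (Fintype.card ι : ℝ) with hm
  have hk1 : 1 ≤ k := by rw [hk]; exact_mod_cast Fintype.card_pos
  have hkm : k ≤ m := by rw [hk, hm]; exact_mod_cast hcard
  have hm0 : 0 < m := by linarith
  have hN0 : (0 : ℝ) < N := lt_of_lt_of_le (by positivity) hN
  -- The barrier starts at `-a k / m`, ends at `c k / m` and moves by `b / m` in each of `N` steps;
  -- `a` is small enough that the vectors not yet selected always carry enough weight.
  set a : ℝ := e / 8 with ha
  set c : ℝ := e ^ 2 / 16 with hc
  set b : ℝ := (a + c) * k / N with hb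
  have ha0 : 0 < a := by positivity
  have hc0 : 0 < c := by positivity
  have hb0 : 0 < b := by positivity
  have hba : b * (1 + e) ≤ a + c := by
    rw [hb, div_mul_eq_mul_div, div_le_iff₀ hN0]
    calc (a + c) * k * (1 + e) = (a + c) * ((1 + e) * k) := by ring
      _ ≤ (a + c) * N := by gcongr
  have hρ : k / m ≤ 1 := (div_le_one hm0).2 hkm
  have hb1 : b < a := by nlinarith
  have hb2 : b ≤ (1 - c) * (1 - b / a) - a := by
    have hr : b / a * (1 + e) ≤ 1 + e / 2 := by
      rw [div_mul_eq_mul_div, div_le_iff₀ ha0]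
      calc _ ≤ _ := hba
        _ = _ := by rw [ha, hc]; ring
    set r := b / a with hrdef
    have hbr : b = e / 8 * r := by rw [hrdef, ha]; field_simp
    rw [hbr, hc, ha]
    have hr' : r ≤ (1 + e / 2) / (1 + e) := by rwa [le_div_iff₀ (by positivity)]
    have hcoef : 0 ≤ e / 8 + (1 - e ^ 2 / 16) := by nlinarith
    have : (e / 8 + (1 - e ^ 2 / 16)) * r ≤
        (e / 8 + (1 - e ^ 2 / 16)) * ((1 + e / 2) / (1 + e)) := by gcongr
    have h2 : (e / 8 + (1 - e ^ 2 / 16)) * ((1 + e / 2) / (1 + e)) ≤ 1 - e ^ 2 / 16 - e / 8 := by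
      rw [mul_div_assoc', div_le_iff₀ (by positivity)]
      have e3 : e ^ 3 ≤ e := by
        have := pow_le_pow_of_le_one he.le he1 (show 1 ≤ 3 by norm_num); simpa using this
      nlinarith
    linarith
  set l : ℕ → ℝ := fun n => -(a * (k / m)) + n * (b / m) with hl
  have key : ∀ n : ℕ, n ≤ N → ∃ J : Finset ι, J.card ≤ n ∧
      (∑ j ∈ J, Matrix.vecMulVec (v j) (star (v j)) - (l n : ℂ) • (1 : Matrix κ κ ℂ)).PosDef ∧
      ((∑ j ∈ J, Matrix.vecMulVec (v j) (star (v j)) -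
        (l n : ℂ) • (1 : Matrix κ κ ℂ))⁻¹).trace.re ≤ m / a := by
    intro n
    induction n with
    | zero =>
      intro _
      have h0 : (0 : Matrix κ κ ℂ) - (l 0 : ℂ) • (1 : Matrix κ κ ℂ) =
          conjDiagonal 1 (fun _ => a * (k / m)) := by
        rw [conjDiagonal_const (by simp)]
        simp [hl]
      refine ⟨∅, by simp, ?_, ?_⟩
      · rw [Finset.sum_empty, h0, posDef_conjDiagonal_iff (by simp)]
        intro _; positivity
      · have hne : ∀ i : κ, (fun _ : κ => a * (k / m)) i ≠ 0 := fun _ => by positivity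
        rw [Finset.sum_empty, h0, Matrix.inv_eq_right_inv (inv_conjDiagonal (by simp) _ hne),
          trace_conjDiagonal (by simp), Complex.ofReal_re]
        apply le_of_eq
        simp only [Finset.sum_const, Finset.card_univ, nsmul_eq_mul, ← hk]
        field_simp
    | succ n ih =>
      intro hn
      obtain ⟨J, hJ, hpd, hpot⟩ := ih (by omega)
      set A := ∑ j ∈ J, Matrix.vecMulVec (v j) (star (v j)) with hA
      have hAps : A.PosSemidef :=
        Matrix.posSemidef_sum _ fun j _ => Matrix.posSemidef_vecMulVec_self_star _
      have hln : l (n + 1) = l n + b / m := by simp only [hl]; push_cast; ring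
      have hl1 : l (n + 1) ≤ c := by
        have : ((n + 1 : ℕ) : ℝ) * (b / m) ≤ N * (b / m) := by gcongr
        have h2 : N * (b / m) = (a + c) * (k / m) := by rw [hb]; field_simp
        have h3 : c * (k / m) ≤ c * 1 := by gcongr
        simp only [hl]
        rw [h2] at this
        linarith
      have hc1 : c < 1 := by rw [hc]; nlinarith
      have hδ : b / m * (m / a) = b / a := by field_simp
      have hba1 : b / a < 1 := (div_lt_one ha0).2 hb1
      obtain ⟨hpd', hor⟩ := barrier_step v Jᶜ A hAps.isHermitian (by
        rw [← hv, hA, ← Finset.sum_add_sum_compl J, add_sub_cancel_left])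
        (l n) (b / m) (m / a) m (by positivity) (by positivity) (by linarith)
        (by rw [hδ]; exact hba1)
        (by rw [hm]; exact_mod_cast Finset.card_le_univ _) (by
          rw [hδ, ← hln]
          have h1 : b / m * m = b := by field_simp
          have h2 : k / (m / a) ≤ a := by
            rw [div_div_eq_mul_div, div_le_iff₀ hm0]; nlinarith
          have h3 : (1 - c) * (1 - b / a) ≤ (1 - l (n + 1)) * (1 - b / a) :=
            mul_le_mul_of_nonneg_right (by linarith) (by linarith)
          rw [h1]
          linarith) hpd hpot
      rw [← hln] at hpd' hor
      rcases hor with h | ⟨j, hj, h⟩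
      · exact ⟨J, by omega, hpd', h⟩
      · rw [Finset.mem_compl] at hj
        refine ⟨insert j J, by rw [Finset.card_insert_of_notMem hj]; omega, ?_, ?_⟩
        · rw [Finset.sum_insert hj, ← hA, add_sub_assoc]
          exact Matrix.PosDef.posSemidef_add (Matrix.posSemidef_vecMulVec_self_star _) hpd'
        · rwa [Finset.sum_insert hj, ← hA, add_comm]
  obtain ⟨J, hJ, hpd, -⟩ := key N le_rfl
  refine ⟨J, hJ, fun x => ?_⟩
  have hlN : l N = c * (k / m) := by simp only [hl, hb]; field_simp; ring
  rw [hlN] at hpd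
  have := hpd.posSemidef.re_dotProduct_nonneg x
  have e1 : star x ⬝ᵥ (∑ j ∈ J, Matrix.vecMulVec (v j) (star (v j)) -
      ((c * (k / m) : ℝ) : ℂ) • (1 : Matrix κ κ ℂ)).mulVec x =
      ((∑ j ∈ J, ‖star (v j) ⬝ᵥ x‖ ^ 2 - c * (k / m) * ∑ i, ‖x i‖ ^ 2 : ℝ) : ℂ) := by
    rw [Matrix.sub_mulVec, dotProduct_sub, Matrix.sum_mulVec, dotProduct_sum]
    push_cast
    congr 1
    · refine Finset.sum_congr rfl fun j _ => ?_
      rw [Matrix.vecMulVec_mulVec, dotProduct_smul, ← Complex.conj_mul', starRingEnd_apply,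
        Matrix.star_dotProduct, star_star, op_smul_eq_mul, mul_comm]
    · rw [Matrix.smul_mulVec, Matrix.one_mulVec, dotProduct_smul, smul_eq_mul]
      congr 1
      exact Finset.sum_congr rfl fun i _ => by rw [← Complex.conj_mul']; rfl
  rw [e1] at this
  simp only [RCLike.re_to_complex, Complex.ofReal_re] at this
  linarith
end

/-! ### Densities in closed shift-invariant families of sets of integers -/

/-- The number of elements of the set with indicator function `x` in the window `[s, s + n)`. -/
noncomputable def windowCount (x : ℤ → Bool) (s : ℤ) (n : ℕ) : ℕ :=
  ((Finset.Ico s (s + n)).filter fun i => x i = true).card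

theorem windowCount_add (x : ℤ → Bool) (s : ℤ) (m n : ℕ) :
    windowCount x s (m + n) = windowCount x s m + windowCount x (s + m) n := by
  unfold windowCount
  rw [← Finset.card_union_of_disjoint, ← Finset.filter_union]
  · push_cast
    rw [← add_assoc, Finset.Ico_union_Ico_eq_Ico (by omega) (by omega)]
  · refine Finset.disjoint_filter_filter (Finset.disjoint_left.mpr fun i hi hj => ?_)
    simp only [Finset.mem_Ico] at hi hj
    omega

theorem windowCount_shift (x : ℤ → Bool) (t s : ℤ) (n : ℕ) :
    windowCount (fun i => x (i + t)) s n = windowCount x (s + t) n := by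
  refine Finset.card_bij (fun i _ => i + t) (fun i hi => ?_) (fun i _ j _ h => by simpa using h)
    (fun i hi => ⟨i - t, ?_, by simp⟩)
  · simp only [Finset.mem_filter, Finset.mem_Ico] at hi ⊢
    exact ⟨by omega, hi.2⟩
  · simp only [Finset.mem_filter, Finset.mem_Ico, sub_add_cancel] at hi ⊢
    exact ⟨by omega, hi.2⟩

theorem windowCount_reflect (x : ℤ → Bool) (s : ℤ) (n : ℕ) :
    windowCount (fun i => x (-1 - i)) s n = windowCount x (-s - n) n := by
  refine Finset.card_bij (fun i _ => -1 - i) (fun i hi => ?_) (fun i _ j _ h => by omega)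
    (fun i hi => ⟨-1 - i, ?_, by simp⟩)
  · simp only [Finset.mem_filter, Finset.mem_Ico] at hi ⊢
    exact ⟨by omega, hi.2⟩
  · simp only [Finset.mem_filter, Finset.mem_Ico, sub_sub_cancel] at hi ⊢
    exact ⟨by omega, hi.2⟩

theorem windowCount_le (x : ℤ → Bool) (s : ℤ) (n : ℕ) : windowCount x s n ≤ n :=
  (Finset.card_filter_le _ _).trans (by simp)

theorem continuous_windowCount (s : ℤ) (n : ℕ) :
    Continuous fun x : ℤ → Bool => windowCount x s n := by
  have : (fun x : ℤ → Bool => windowCount x s n) =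
      fun x => ∑ i ∈ Finset.Ico s (s + n), (fun b : Bool => if b = true then 1 else 0) (x i) := by
    ext x; exact Finset.card_filter _ _
  rw [this]
  refine continuous_finsetSum _ fun i _ => ?_
  exact (continuous_of_discreteTopology (f := fun b : Bool => if b = true then 1 else 0)).comp
    (continuous_apply i)

/-- A maximal inequality. Suppose that windows of length `n` contain at least `β n - K` elements. If
every point of `B` starts a window that is heavy, having at least `(β + ε) n + K` elements, then the
elements in excess of `β T - K` of a window of length `T` number at least `ε` times the points of
`B` in it. The points less than `L` from the right end are discarded, so that the heavy windows do
not stick out. -/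
theorem windowCount_ge_of_heavy (x : ℤ → Bool) (β ε K : ℝ) (hε : 0 ≤ ε)
    (hlow : ∀ s n, β * n - K ≤ windowCount x s n) (L : ℕ) (B : ℤ → Prop) [DecidablePred B]
    (hB : ∀ b, B b → ∃ n : ℕ, 0 < n ∧ n ≤ L ∧ (β + ε) * n + K ≤ windowCount x b n)
    (T : ℕ) : ∀ s : ℤ,
    β * T - K + ε * ((Finset.Ico s (s + T)).filter fun b => b + L ≤ s + T ∧ B b).card ≤
      windowCount x s T := by
  induction T using Nat.strong_induction_on with
  | _ T ih =>
    intro s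
    by_cases hex : ∃ g : ℕ, s + g + L ≤ s + T ∧ B (s + g)
    · -- the leftmost heavy window
      obtain ⟨g, ⟨hgT, hgB⟩, hmin⟩ : ∃ g : ℕ, (s + g + L ≤ s + T ∧ B (s + g)) ∧
          ∀ g' : ℕ, g' < g → ¬ (s + g' + L ≤ s + T ∧ B (s + g')) := by
        classical exact ⟨Nat.find hex, Nat.find_spec hex, fun _ h => Nat.find_min hex h⟩
      obtain ⟨n, hn0, hnL, hn⟩ := hB _ hgB
      obtain ⟨T', rfl⟩ : ∃ T', T = g + n + T' := ⟨T - (g + n), by omega⟩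
      have h1 := ih T' (by omega) (s + g + n)
      have h2 := hlow s g
      have hcard : ((Finset.Ico s (s + (g + n + T' : ℕ))).filter
          fun b => b + L ≤ s + (g + n + T' : ℕ) ∧ B b).card ≤
          n + ((Finset.Ico (s + g + n) (s + g + n + T')).filter
            fun b => b + L ≤ s + g + n + T' ∧ B b).card := by
        have hsub : ((Finset.Ico s (s + (g + n + T' : ℕ))).filter
          fun b => b + L ≤ s + (g + n + T' : ℕ) ∧ B b) ⊆ Finset.Ico (s + g) (s + g + n) ∪
            ((Finset.Ico (s + g + n) (s + g + n + T')).filter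
            fun b => b + L ≤ s + g + n + T' ∧ B b) := by
          intro b hb
          simp only [Finset.mem_filter, Finset.mem_Ico, Finset.mem_union] at hb ⊢
          obtain ⟨⟨hb1, hb2⟩, hb3, hb4⟩ := hb
          push_cast at hb2 hb3
          have : s + g ≤ b := by
            by_contra hlt
            obtain ⟨g', rfl⟩ : ∃ g' : ℕ, b = s + g' := ⟨(b - s).toNat, by omega⟩
            exact hmin g' (by omega) ⟨by push_cast; omega, hb4⟩
          by_cases hc : b < s + g + n
          · left; omega
          · right; exact ⟨by omega, by omega, hb4⟩
        refine (Finset.card_le_card hsub).trans ((Finset.card_union_le _ _).trans ?_)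
        simp
      have hcard' : (((Finset.Ico s (s + (g + n + T' : ℕ))).filter
          fun b => b + L ≤ s + (g + n + T' : ℕ) ∧ B b).card : ℝ) ≤
          n + ((Finset.Ico (s + g + n) (s + g + n + T')).filter
            fun b => b + L ≤ s + g + n + T' ∧ B b).card := by exact_mod_cast hcard
      generalize ((Finset.Ico s (s + (g + n + T' : ℕ))).filter
          fun b => b + L ≤ s + (g + n + T' : ℕ) ∧ B b).card = c at hcard' ⊢
      have hmul := mul_le_mul_of_nonneg_left hcard' hε
      rw [windowCount_add, windowCount_add,
        show s + ((g + n : ℕ) : ℤ) = s + g + n by push_cast; ring]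
      simp only [Nat.cast_add]
      linarith
    · have : ((Finset.Ico s (s + T)).filter fun b => b + L ≤ s + T ∧ B b) = ∅ := by
        rw [Finset.filter_eq_empty_iff]
        rintro b hb ⟨h1, h2⟩
        simp only [Finset.mem_Ico] at hb
        obtain ⟨g', rfl⟩ : ∃ g' : ℕ, b = s + g' := ⟨(b - s).toNat, by omega⟩
        exact hex ⟨g', h1, h2⟩
      rw [this]
      simpa using hlow s T

/-- In a closed shift-invariant family whose windows have density at least `α - o(1)`, uniformly,
and which contains for every `T` a member with density at most `α` in `[0, T)`, some member has
density at most `α + o(1)` on both sides of the origin. -/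
theorem exists_mem_forall_windowCount_le {X : Set (ℤ → Bool)} (hX : IsClosed X)
    (hshift : ∀ x ∈ X, ∀ t : ℤ, (fun i => x (i + t)) ∈ X) (α : ℝ)
    (hlow : ∀ δ > 0, ∃ K : ℝ, ∀ x ∈ X, ∀ s n, (α - δ) * n - K ≤ windowCount x s n)
    (hopt : ∀ T : ℕ, ∃ x ∈ X, (windowCount x 0 T : ℝ) ≤ α * T) :
    ∃ x ∈ X, ∀ ε > 0, ∃ K : ℝ, ∀ n : ℕ, (windowCount x 0 n : ℝ) ≤ (α + ε) * n + K ∧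
      (windowCount x (-n) n : ℝ) ≤ (α + ε) * n + K := by
  classical
  set ε : ℕ → ℝ := fun k => 1 / ((k : ℝ) + 1) with hε
  have hε0 : ∀ k, 0 < ε k := fun k => by simp only [hε]; positivity
  -- the factor `2⁻ᵏ / 8` bounds the total proportion of bad points over all scales by `1 / 2`
  set δ : ℕ → ℝ := fun k => ε k * ((1 / 2) ^ k / 8) with hδ
  have hδ0 : ∀ k, 0 < δ k := fun k => by have := hε0 k; simp only [hδ]; positivity
  choose K hK using fun k => hlow (δ k) (hδ0 k)
  set G : ℕ → Set (ℤ → Bool) := fun L => X ∩ {x | ∀ k < L, ∀ n ≤ L, 0 < n →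
    (windowCount x 0 n : ℝ) ≤ (α - δ k + ε k) * n + K k ∧
      (windowCount x (-n) n : ℝ) ≤ (α - δ k + ε k) * n + K k} with hG
  have hclosed : ∀ L, IsClosed (G L) := by
    intro L
    refine hX.inter ?_
    have hc : ∀ s n, Continuous fun x : ℤ → Bool => (windowCount x s n : ℝ) := fun s n =>
      continuous_of_discreteTopology.comp (continuous_windowCount s n)
    simp only [Set.ofPred_forall]
    refine isClosed_iInter fun k => isClosed_iInter fun _ => isClosed_iInter fun n =>
      isClosed_iInter fun _ => isClosed_iInter fun _ => ?_
    exact (isClosed_le (hc _ _) continuous_const).inter (isClosed_le (hc _ _) continuous_const)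
  have hne : ∀ L, (G L).Nonempty := by
    intro L
    set C : ℝ := ∑ k ∈ Finset.range L, 2 * (K k / ε k) with hC
    obtain ⟨T, hT⟩ := exists_nat_gt (2 * C + 4 * L)
    obtain ⟨x, hxX, hx⟩ := hopt T
    set bad : ℕ → (ℤ → Bool) → ℤ → Prop := fun k y b =>
      ∃ n : ℕ, 0 < n ∧ n ≤ L ∧ (α - δ k + ε k) * n + K k ≤ windowCount y b n with hbad
    set y : ℤ → Bool := fun i => x (-1 - i) with hy
    have hylow : ∀ k s n, (α - δ k) * n - K k ≤ windowCount y s n := fun k s n => by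
      rw [hy, windowCount_reflect]; exact hK k x hxX _ _
    set R : ℕ → Finset ℤ := fun k => (Finset.Ico (0 : ℤ) (0 + T)).filter
      fun b => b + L ≤ 0 + T ∧ bad k x b with hR
    set R' : ℕ → Finset ℤ := fun k => (Finset.Ico (-(T : ℤ)) (-T + T)).filter
      fun b => b + L ≤ -T + T ∧ bad k y b with hR'
    have hbound : ∀ k (z : ℤ → Bool) (s : ℤ), (∀ s n, (α - δ k) * n - K k ≤ windowCount z s n) →
        (windowCount z s T : ℝ) ≤ α * T →
        (((Finset.Ico s (s + T)).filter fun b => b + L ≤ s + T ∧ bad k z b).card : ℝ) ≤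
          (1 / 2) ^ k / 8 * T + K k / ε k := by
      intro k z s hz hzT
      have h := windowCount_ge_of_heavy z (α - δ k) (ε k) (K k) (hε0 k).le hz L (bad k z)
        (fun b hb => hb) T s
      have h2 : ε k * (((Finset.Ico s (s + T)).filter fun b => b + L ≤ s + T ∧ bad k z b).card : ℝ)
          ≤ ε k * ((1 / 2) ^ k / 8 * T + K k / ε k) := by
        have e : ε k * ((1 / 2) ^ k / 8 * T + K k / ε k) = δ k * T + K k := by
          have := hε0 k
          simp only [hδ]; field_simp
        rw [e]; linarith
      exact le_of_mul_le_mul_left h2 (hε0 k)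
    -- points with an excess to the right, and the mirror images of those with one to the left
    have hRb : ∀ k, ((R k).card : ℝ) ≤ (1 / 2) ^ k / 8 * T + K k / ε k := fun k =>
      hbound k x 0 (hK k x hxX) hx
    have hRb' : ∀ k, ((R' k).card : ℝ) ≤ (1 / 2) ^ k / 8 * T + K k / ε k := fun k =>
      hbound k y (-T) (hylow k) (by rw [hy, windowCount_reflect]; simpa using hx)
    set V : Finset ℤ := (Finset.range L).biUnion fun k => R k ∪ (R' k).image fun b => -b with hV
    have hVcard : (V.card : ℝ) ≤ T / 2 + C := by
      have h1 : (V.card : ℝ) ≤ ∑ k ∈ Finset.range L, (((R k).card : ℝ) + (R' k).card) := by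
        have : V.card ≤ ∑ k ∈ Finset.range L, ((R k).card + (R' k).card) :=
          Finset.card_biUnion_le.trans (Finset.sum_le_sum fun k _ =>
            (Finset.card_union_le _ _).trans (Nat.add_le_add_left Finset.card_image_le _))
        exact_mod_cast this
      have h2 : ∑ k ∈ Finset.range L, (((R k).card : ℝ) + (R' k).card) ≤
          ∑ k ∈ Finset.range L, ((1 / 2 : ℝ) ^ k * (T / 4) + 2 * (K k / ε k)) :=
        Finset.sum_le_sum fun k _ => by linarith [hRb k, hRb' k]
      rw [Finset.sum_add_distrib (f := fun k => (1 / 2 : ℝ) ^ k * (T / 4)), ← Finset.sum_mul,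
        ← hC] at h2
      have h3 : ∑ k ∈ Finset.range L, (1 / 2 : ℝ) ^ k ≤ 2 := by
        have := sum_geometric_two_le L
        simpa using this
      have h4 : (∑ k ∈ Finset.range L, (1 / 2 : ℝ) ^ k) * (T / 4) ≤ 2 * (T / 4) := by gcongr
      linarith
    obtain ⟨b, hb, hbV⟩ : ∃ b ∈ Finset.Icc (L : ℤ) (T - L), b ∉ V := by
      by_contra! hcon
      have h1 := Finset.card_le_card hcon
      have h2 : ((T : ℝ) - 2 * L) ≤ V.card := by
        have : (T : ℤ) - 2 * L ≤ V.card := by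
          rw [Int.card_Icc] at h1; omega
        exact_mod_cast this
      linarith
    refine ⟨fun i => x (i + b), hshift x hxX b, fun k hk n hnL hn0 => ?_⟩
    rw [Finset.mem_Icc] at hb
    rw [windowCount_shift, windowCount_shift]
    constructor
    · by_contra! hcon
      refine hbV (Finset.mem_biUnion.2 ⟨k, Finset.mem_range.2 hk, Finset.mem_union_left _ ?_⟩)
      simp only [hR, Finset.mem_filter, Finset.mem_Ico]
      refine ⟨by omega, by omega, n, hn0, hnL, ?_⟩
      rw [zero_add] at hcon
      exact hcon.le
    · by_contra! hcon
      refine hbV (Finset.mem_biUnion.2 ⟨k, Finset.mem_range.2 hk, Finset.mem_union_right _ ?_⟩)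
      refine Finset.mem_image.2 ⟨-b, ?_, by simp⟩
      simp only [hR', Finset.mem_filter, Finset.mem_Ico]
      refine ⟨by omega, by omega, n, hn0, hnL, ?_⟩
      rw [hy, windowCount_reflect, neg_neg, sub_eq_neg_add b]
      exact hcon.le
  obtain ⟨x, hx⟩ := IsCompact.nonempty_iInter_of_sequence_nonempty_isCompact_isClosed G
    (fun L x hx => ⟨hx.1, fun k hk n hn => hx.2 k (by omega) n (by omega)⟩) hne
    (hclosed 0).isCompact hclosed
  rw [Set.mem_iInter] at hx
  refine ⟨x, (hx 0).1, fun η hη => ?_⟩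
  obtain ⟨k, hk⟩ := exists_nat_one_div_lt hη
  refine ⟨max (K k) 0, fun n => ?_⟩
  rcases Nat.eq_zero_or_pos n with rfl | hn
  · simp [windowCount]
  · obtain ⟨h1, h2⟩ := (hx (max (k + 1) n)).2 k (by omega) n (by omega) hn
    have h3 : (α - δ k + ε k) * n ≤ (α + η) * n := by
      gcongr
      have := hδ0 k
      have : ε k < η := hk
      linarith
    have := le_max_left (K k) 0
    exact ⟨by linarith, by linarith⟩

/-- A closed shift-invariant family of sets of integers that contains, for every `T`, a member with
at most `D T` elements in `[0, T)`, contains a member that has a symmetric density, at most `D`. -/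
theorem exists_mem_hasSymmetricDensity {X : Set (ℤ → Bool)} (hX : IsClosed X)
    (hshift : ∀ x ∈ X, ∀ t : ℤ, (fun i => x (i + t)) ∈ X) (D : ℝ)
    (hD : ∀ T : ℕ, ∃ x ∈ X, (windowCount x 0 T : ℝ) ≤ D * T) :
    ∃ x ∈ X, ∃ D' ≤ D, HasSymmetricDensity {i | x i = true} D' := by
  -- the least number of elements in a window of length `n`
  set a : ℕ → ℕ := fun n => sInf ((fun x => windowCount x 0 n) '' X) with ha
  obtain ⟨x₀, hx₀, -⟩ := hD 0
  have hne : ∀ n, ((fun x => windowCount x 0 n) '' X).Nonempty := fun n => ⟨_, x₀, hx₀, rfl⟩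
  have hale : ∀ x ∈ X, ∀ s n, a n ≤ windowCount x s n := by
    intro x hx s n
    refine Nat.sInf_le ⟨_, hshift x hx s, ?_⟩
    simp only [windowCount_shift, zero_add]
  have hsub : Subadditive fun n => -(a n : ℝ) := by
    intro m n
    obtain ⟨x, hx, hxa⟩ := Nat.sInf_mem (hne (m + n))
    have : a m + a n ≤ a (m + n) := by
      rw [show a (m + n) = windowCount x 0 (m + n) from hxa.symm, windowCount_add]
      exact add_le_add (hale x hx _ _) (hale x hx _ _)
    have : (a m : ℝ) + a n ≤ a (m + n) := by exact_mod_cast this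
    linarith
  have hbdd : BddBelow (Set.range fun n : ℕ => -(a n : ℝ) / n) := by
    refine ⟨-1, ?_⟩
    rintro _ ⟨n, rfl⟩
    have : (a n : ℝ) ≤ n := by exact_mod_cast (hale x₀ hx₀ 0 n).trans (windowCount_le _ _ _)
    rcases Nat.eq_zero_or_pos n with rfl | hn
    · simp
    · have : (0 : ℝ) < n := by exact_mod_cast hn
      simp only
      rw [le_div_iff₀ this]; linarith
  set α : ℝ := -hsub.lim with hα
  have hlim := hsub.tendsto_lim hbdd
  have haα : ∀ n, (a n : ℝ) ≤ α * n := by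
    intro n
    rcases Nat.eq_zero_or_pos n with rfl | hn
    · have := (hale x₀ hx₀ 0 0).trans (windowCount_le _ _ _)
      simp at this; simp [this]
    · have h1 := hsub.lim_le_div hbdd hn.ne'
      have : (0 : ℝ) < n := by exact_mod_cast hn
      rw [le_div_iff₀ this] at h1
      rw [hα]; linarith
  have hlow : ∀ δ > 0, ∃ K : ℝ, ∀ x ∈ X, ∀ s n, (α - δ) * n - K ≤ windowCount x s n := by
    intro δ hδ
    have hev : ∀ᶠ n : ℕ in atTop, -(a n : ℝ) / n < hsub.lim + δ :=
      hlim.eventually_lt_const (by linarith)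
    obtain ⟨n₀, hn₀⟩ := eventually_atTop.1 hev
    refine ⟨|α - δ| * n₀, fun x hx s n => ?_⟩
    have hax : (a n : ℝ) ≤ windowCount x s n := by exact_mod_cast hale x hx s n
    rcases Nat.eq_zero_or_pos n with rfl | hn
    · have : 0 ≤ |α - δ| * n₀ := by positivity
      push_cast
      have : (0 : ℝ) ≤ windowCount x s 0 := by positivity
      linarith
    have hn' : (0 : ℝ) < n := by exact_mod_cast hn
    rcases le_or_gt n₀ n with h | h
    · have := hn₀ n h
      rw [div_lt_iff₀ hn'] at this
      have h3 : 0 ≤ |α - δ| * n₀ := by positivity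
      rw [hα] at h3 ⊢
      linarith
    · have h1 : (α - δ) * n ≤ |α - δ| * n₀ := by
        have : (n : ℝ) ≤ n₀ := by exact_mod_cast h.le
        calc (α - δ) * n ≤ |α - δ| * n := by gcongr; exact le_abs_self _
          _ ≤ _ := by gcongr
      have : (0 : ℝ) ≤ windowCount x s n := by positivity
      linarith
  have hopt : ∀ T : ℕ, ∃ x ∈ X, (windowCount x 0 T : ℝ) ≤ α * T := by
    intro T
    obtain ⟨x, hx, hxa⟩ := Nat.sInf_mem (hne T)
    refine ⟨x, hx, ?_⟩
    simp only at hxa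
    rw [hxa]; exact haα T
  obtain ⟨x, hx, hup⟩ := exists_mem_forall_windowCount_le hX hshift α hlow hopt
  refine ⟨x, hx, α, ?_, ?_⟩
  · have : -D ≤ hsub.lim := by
      refine ge_of_tendsto hlim (eventually_atTop.2 ⟨1, fun n hn => ?_⟩)
      have hn' : (0 : ℝ) < n := by exact_mod_cast hn
      obtain ⟨y, hy, hyD⟩ := hD n
      have : (a n : ℝ) ≤ windowCount y 0 n := by exact_mod_cast hale y hy 0 n
      rw [le_div_iff₀ hn']; linarith
    rw [hα]; linarith
  · have hcount : ∀ n : ℕ, windowCount x (-n) n + windowCount x 0 n ≤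
        ({i | x i = true} ∩ Set.Icc (-(n : ℤ)) (n : ℤ)).ncard ∧
        ({i | x i = true} ∩ Set.Icc (-(n : ℤ)) (n : ℤ)).ncard ≤
          windowCount x (-n) n + windowCount x 0 n + 1 := by
      intro n
      have e1 : ({i | x i = true} ∩ Set.Icc (-(n : ℤ)) (n : ℤ)).ncard =
          windowCount x (-n) (n + n + 1) := by
        rw [windowCount, ← Set.ncard_coe_finset]
        congr 1
        ext i
        simp only [Set.mem_inter_iff, Set.mem_ofPred_eq, Set.mem_Icc, Finset.coe_filter,
          Finset.mem_Ico]
        push_cast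
        constructor
        · rintro ⟨h, h1, h2⟩; exact ⟨⟨h1, by omega⟩, h⟩
        · rintro ⟨⟨h1, h2⟩, h⟩; exact ⟨h, h1, by omega⟩
      rw [e1, windowCount_add, windowCount_add, neg_add_cancel]
      have := windowCount_le x (-n + (n + n : ℕ)) 1
      omega
    rw [HasSymmetricDensity, Metric.tendsto_atTop]
    intro η hη
    obtain ⟨K₁, hK₁⟩ := hlow (η / 2) (by positivity)
    obtain ⟨K₂, hK₂⟩ := hup (η / 2) (by positivity)
    obtain ⟨n₀, hn₀⟩ := exists_nat_gt ((2 * |K₁| + 2 * |K₂| + 1) / η)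
    refine ⟨n₀ + 1, fun n hn => ?_⟩
    have hn' : (0 : ℝ) < n := by
      have : 0 < n := by omega
      exact_mod_cast this
    have hnn : (n₀ : ℝ) ≤ n := by
      have : n₀ ≤ n := by omega
      exact_mod_cast this
    obtain ⟨h1, h2⟩ := hcount n
    have h1' : (windowCount x (-n) n : ℝ) + windowCount x 0 n ≤
        ({i | x i = true} ∩ Set.Icc (-(n : ℤ)) (n : ℤ)).ncard := by exact_mod_cast h1
    have h2' : (({i | x i = true} ∩ Set.Icc (-(n : ℤ)) (n : ℤ)).ncard : ℝ) ≤
        windowCount x (-n) n + windowCount x 0 n + 1 := by exact_mod_cast h2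
    have l1 := hK₁ x hx (-n) n
    have l2 := hK₁ x hx 0 n
    obtain ⟨u1, u2⟩ := hK₂ n
    have hbig : 2 * |K₁| + 2 * |K₂| + 1 < η * n := by
      rw [div_lt_iff₀ hη] at hn₀
      nlinarith
    have := le_abs_self K₁
    have := le_abs_self K₂
    have := abs_nonneg K₁
    have := abs_nonneg K₂
    rw [Real.dist_eq, abs_lt]
    constructor
    · rw [lt_sub_iff_add_lt, lt_div_iff₀ (by positivity)]
      nlinarith
    · rw [sub_lt_iff_lt_add, div_lt_iff₀ (by positivity)]
      nlinarith

/-! ### Sampling on the integers -/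

/-- The value at the integer `n` of the function with Fourier transform `g` supported in
`[0, 1]`. -/
noncomputable def sample (g : ℝ → ℂ) (n : ℤ) : ℂ :=
  ∫ ξ in (0 : ℝ)..1, Complex.exp (2 * Real.pi * Complex.I * n * ξ) * g ξ

theorem sample_eq_fourierCoeffOn (g : ℝ → ℂ) (n : ℤ) :
    sample g n = fourierCoeffOn zero_lt_one g (-n) := by
  rw [fourierCoeffOn_eq_integral, sample]
  simp only [fourier_coe_apply, neg_neg, smul_eq_mul, sub_zero, div_one, one_smul,
    Complex.ofReal_one]

theorem hasSum_sample {g : ℝ → ℂ} (hg : MemLp g 2 volume)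
    (hsupp : ∀ ξ ∉ Set.Ioc (0 : ℝ) 1, g ξ = 0) :
    HasSum (fun n : ℤ => ‖sample g n‖ ^ 2) (∫ ξ, ‖g ξ‖ ^ 2) := by
  have h := hasSum_sq_fourierCoeffOn zero_lt_one (hg.restrict (Set.Ioc 0 1))
  rw [← (Equiv.neg ℤ).hasSum_iff] at h
  convert! h using 1
  · ext n; simp [sample_eq_fourierCoeffOn]
  · rw [intervalIntegral.integral_of_le zero_le_one,
      setIntegral_eq_integral_of_forall_compl_eq_zero]
    · simp
    · intro ξ hξ; simp [hsupp ξ hξ]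

theorem summable_ite_sample {g : ℝ → ℂ} (hg : MemLp g 2 volume)
    (hsupp : ∀ ξ ∉ Set.Ioc (0 : ℝ) 1, g ξ = 0) (x : ℤ → Bool) :
    Summable fun n : ℤ => if x n = true then ‖sample g n‖ ^ 2 else 0 :=
  Summable.of_nonneg_of_le (fun n => by split_ifs <;> positivity)
    (fun n => by split_ifs; exacts [le_rfl, by positivity]) (hasSum_sample hg hsupp).summable

/-- The set with indicator function `x` is a sampling set, with lower bound `c`, for the functions
whose Fourier transform lives on `E`. -/
def IsSampling (c : ℝ) (E : Set ℝ) (x : ℤ → Bool) : Prop :=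
  ∀ g : ℝ → ℂ, MemLp g 2 volume → (∀ ξ ∉ E, g ξ = 0) →
    c * ∫ ξ, ‖g ξ‖ ^ 2 ≤ ∑' n : ℤ, if x n = true then ‖sample g n‖ ^ 2 else 0

theorem IsSampling.mono {c c' : ℝ} {E E' : Set ℝ} {x : ℤ → Bool} (h : IsSampling c E x)
    (hc : c' ≤ c) (hE : E' ⊆ E) : IsSampling c' E' x := fun g hg hsupp =>
  (mul_le_mul_of_nonneg_right hc (integral_nonneg fun _ => by positivity)).trans
    (h g hg fun ξ hξ => hsupp ξ fun h' => hξ (hE h'))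

/-- For each function the sum of the squared samples over a set is dominated by the convergent sum
over `ℤ`, hence depends continuously on the set. -/
theorem isClosed_isSampling (c : ℝ) {E : Set ℝ} (hE : E ⊆ Set.Ioc 0 1) :
    IsClosed {x | IsSampling c E x} := by
  simp only [IsSampling, Set.ofPred_forall]
  refine isClosed_iInter fun g => isClosed_iInter fun hg => isClosed_iInter fun hsupp => ?_
  refine isClosed_le continuous_const ?_
  refine continuous_tsum (u := fun n => ‖sample g n‖ ^ 2) (fun n => ?_)
    (hasSum_sample hg fun ξ hξ => hsupp ξ fun h => hξ (hE h)).summable fun n x => ?_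
  · exact (continuous_of_discreteTopology
      (f := fun b : Bool => if b = true then ‖sample g n‖ ^ 2 else 0)).comp (continuous_apply n)
  · split_ifs <;> simp

theorem IsSampling.shift {c : ℝ} {E : Set ℝ} {x : ℤ → Bool} (h : IsSampling c E x) (t : ℤ) :
    IsSampling c E fun n => x (n + t) := by
  intro g hg hsupp
  set u : ℝ → ℂ := fun ξ => Complex.exp (2 * Real.pi * Complex.I * (-t : ℤ) * ξ) with hu
  have hun : ∀ ξ, ‖u ξ‖ = 1 := fun ξ => by
    have : (2 * Real.pi * Complex.I * (-t : ℤ) * ξ : ℂ) =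
      ((2 * Real.pi * (-t : ℤ) * ξ : ℝ) : ℂ) * Complex.I := by push_cast; ring
    rw [hu]
    simp only
    rw [this, Complex.norm_exp_ofReal_mul_I]
  have hnorm : ∀ ξ, ‖u ξ * g ξ‖ = ‖g ξ‖ := fun ξ => by rw [norm_mul, hun, one_mul]
  have hu' : Continuous u := by fun_prop
  have hmem : MemLp (fun ξ => u ξ * g ξ) 2 volume :=
    hg.of_le (hu'.aestronglyMeasurable.mul hg.1) (ae_of_all _ fun ξ => (hnorm ξ).le)
  have := h (fun ξ => u ξ * g ξ) hmem fun ξ hξ => by simp [hsupp ξ hξ]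
  simp only [hnorm] at this
  rw [← (Equiv.addRight t).tsum_eq] at this
  refine this.trans (le_of_eq (tsum_congr fun n => ?_))
  simp only [Equiv.coe_addRight]
  have hs : sample (fun ξ => u ξ * g ξ) (n + t) = sample g n := by
    simp only [sample]
    refine intervalIntegral.integral_congr fun ξ _ => ?_
    simp only [hu]
    rw [← mul_assoc, ← Complex.exp_add]
    congr 2
    push_cast; ring
  rw [hs]
  rfl

theorem sample_add {g h : ℝ → ℂ} (hg : MemLp g 2 volume) (hh : MemLp h 2 volume) (n : ℤ) :
    sample (fun ξ => g ξ + h ξ) n = sample g n + sample h n := by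
  simp only [sample, mul_add]
  have : ∀ f : ℝ → ℂ, MemLp f 2 volume → IntervalIntegrable
      (fun ξ : ℝ => Complex.exp (2 * Real.pi * Complex.I * n * ξ) * f ξ) volume 0 1 := by
    intro f hf
    have hf' : IntervalIntegrable f volume 0 1 := by
      rw [intervalIntegrable_iff_integrableOn_Ioc_of_le zero_le_one]
      exact (hf.restrict _).integrable (by norm_num)
    exact hf'.continuousOn_mul (by fun_prop)
  exact intervalIntegral.integral_add (this g hg) (this h hh)

/-- The sampling inequality passes from the compact subsets of `E` that contain `K₀` to `E`. The
set `K₀` allows the constant `c` to be one that is only available for compact sets of large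
measure. -/
theorem isSampling_of_exhaustion {c : ℝ} (hc : 0 ≤ c) {E : Set ℝ} (hEm : MeasurableSet E)
    (hE : E ⊆ Set.Ioc 0 1) {K₀ : Set ℝ} (hK₀ : IsCompact K₀) (hK₀E : K₀ ⊆ E) {x : ℤ → Bool}
    (h : ∀ K, IsCompact K → K₀ ⊆ K → K ⊆ E → IsSampling c K x) : IsSampling c E x := by
  intro g hg hsupp
  have hsupp' : ∀ ξ ∉ Set.Ioc (0 : ℝ) 1, g ξ = 0 := fun ξ hξ => hsupp ξ fun h => hξ (hE h)
  set G := ∫ ξ, ‖g ξ‖ ^ 2 with hG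
  set S := ∑' n : ℤ, if x n = true then ‖sample g n‖ ^ 2 else 0 with hS
  have hint : Integrable (fun ξ => ‖g ξ‖ ^ 2) volume := hg.integrable_norm_pow (by norm_num)
  have key : ∀ η : ℝ, 0 < η → c * (G - η ^ 2) ≤ (1 + η) * S + (1 + η⁻¹) * η ^ 2 := by
    intro η hη
    -- inner regularity of `|g|² dξ` gives a compact set carrying almost all of the energy of `g`
    set ν : Measure ℝ := volume.withDensity fun ξ => ENNReal.ofReal (‖g ξ‖ ^ 2) with hν
    have : IsFiniteMeasure ν := isFiniteMeasure_withDensity_ofReal hint.2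
    obtain ⟨K₁, hK₁E, hK₁, hν₁⟩ := hEm.exists_isCompact_sdiff_lt (μ := ν) (measure_ne_top _ _)
      (ε := ENNReal.ofReal (η ^ 2)) (by simp; positivity)
    set K := K₀ ∪ K₁ with hKdef
    have hK : IsCompact K := hK₀.union hK₁
    have hKm : MeasurableSet K := hK.measurableSet
    have hKE : K ⊆ E := Set.union_subset hK₀E hK₁E
    have hνK : ν Kᶜ < ENNReal.ofReal (η ^ 2) := by
      have h0 : ν Eᶜ = 0 := by
        rw [hν, withDensity_apply _ hEm.compl]
        rw [setLIntegral_congr_fun (g := 0) hEm.compl (fun ξ hξ => by simp [hsupp ξ hξ])]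
        simp
      calc ν Kᶜ ≤ ν (E \ K₁ ∪ Eᶜ) := measure_mono fun ξ hξ => by
            by_cases hξE : ξ ∈ E
            · exact Or.inl ⟨hξE, fun h => hξ (Or.inr h)⟩
            · exact Or.inr hξE
        _ ≤ ν (E \ K₁) + ν Eᶜ := measure_union_le _ _
        _ < _ := by rw [h0, add_zero]; exact hν₁
    set p : ℝ → ℂ := K.indicator g with hp
    set r : ℝ → ℂ := Kᶜ.indicator g with hr
    have hpm : MemLp p 2 volume := hg.indicator hKm
    have hrm : MemLp r 2 volume := hg.indicator hKm.compl
    have hps : ∀ ξ ∉ K, p ξ = 0 := fun ξ hξ => Set.indicator_of_notMem hξ _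
    have hrs : ∀ ξ ∉ Set.Ioc (0 : ℝ) 1, r ξ = 0 := fun ξ hξ => by
      by_cases hξK : ξ ∈ K <;> simp [hr, hξK, hsupp' ξ hξ]
    have hR : ∫ ξ, ‖r ξ‖ ^ 2 ≤ η ^ 2 := by
      have e : ∀ ξ, ‖r ξ‖ ^ 2 = Kᶜ.indicator (fun ξ => ‖g ξ‖ ^ 2) ξ := fun ξ => by
        rw [hr]; by_cases h : ξ ∈ Kᶜ <;> simp [h]
      simp only [e]
      rw [integral_indicator hKm.compl, integral_eq_lintegral_of_nonneg_ae
        (ae_of_all _ fun _ => by positivity) hint.1.restrict, ← withDensity_apply _ hKm.compl]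
      exact ENNReal.toReal_le_of_le_ofReal (by positivity) hνK.le
    have hPR : ∫ ξ, ‖p ξ‖ ^ 2 = G - ∫ ξ, ‖r ξ‖ ^ 2 := by
      rw [eq_sub_iff_add_eq, hG, ← integral_add (hpm.integrable_norm_pow (by norm_num))
        (hrm.integrable_norm_pow (by norm_num))]
      refine integral_congr_ae (ae_of_all _ fun ξ => ?_)
      by_cases hξ : ξ ∈ K <;> simp [hp, hr, hξ]
    have hsamp : ∀ n, ‖sample p n‖ ^ 2 ≤
        (1 + η) * ‖sample g n‖ ^ 2 + (1 + η⁻¹) * ‖sample r n‖ ^ 2 := by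
      intro n
      have e : sample g n = sample p n + sample r n := by
        rw [← sample_add hpm hrm]
        congr 1; ext ξ
        by_cases hξ : ξ ∈ K <;> simp [hp, hr, hξ]
      have h1 : ‖sample p n‖ ≤ ‖sample g n‖ + ‖sample r n‖ := by
        rw [show sample p n = sample g n - sample r n by rw [e]; ring]
        exact norm_sub_le _ _
      have h2 : 2 * ‖sample g n‖ * ‖sample r n‖ ≤
          η * ‖sample g n‖ ^ 2 + η⁻¹ * ‖sample r n‖ ^ 2 := by
        have h3 : 0 ≤ η⁻¹ * (η * ‖sample g n‖ - ‖sample r n‖) ^ 2 := by positivity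
        have h4 : η⁻¹ * (η * ‖sample g n‖ - ‖sample r n‖) ^ 2 = η * ‖sample g n‖ ^ 2 -
            2 * ‖sample g n‖ * ‖sample r n‖ + η⁻¹ * ‖sample r n‖ ^ 2 := by
          field_simp; ring
        linarith
      calc ‖sample p n‖ ^ 2 ≤ (‖sample g n‖ + ‖sample r n‖) ^ 2 := by gcongr
        _ ≤ _ := by nlinarith
    have hle := h K hK Set.subset_union_left hKE p hpm hps
    have hsg := summable_ite_sample hg hsupp' x
    have hsr := (hasSum_sample hrm hrs).summable
    have hub : (∑' n : ℤ, if x n = true then ‖sample p n‖ ^ 2 else 0) ≤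
        (1 + η) * S + (1 + η⁻¹) * ∫ ξ, ‖r ξ‖ ^ 2 := by
      rw [hS, ← (hasSum_sample hrm hrs).tsum_eq, ← tsum_mul_left, ← tsum_mul_left,
        ← (hsg.mul_left _).tsum_add (hsr.mul_left _)]
      refine Summable.tsum_le_tsum (fun n => ?_) (summable_ite_sample hpm (fun ξ hξ =>
        hps ξ fun h => hξ (hE (hKE h))) x) ((hsg.mul_left _).add (hsr.mul_left _))
      split_ifs
      · exact hsamp n
      · positivity
    have hη' : 0 < 1 + η⁻¹ := by positivity
    calc c * (G - η ^ 2) ≤ c * ∫ ξ, ‖p ξ‖ ^ 2 := by rw [hPR]; gcongr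
      _ ≤ _ := hle
      _ ≤ _ := hub
      _ ≤ _ := by gcongr
  have hlim1 : Tendsto (fun η : ℝ => c * (G - η ^ 2)) (𝓝[>] 0) (𝓝 (c * G)) := by
    have : Continuous fun η : ℝ => c * (G - η ^ 2) := by fun_prop
    simpa using (this.tendsto 0).mono_left nhdsWithin_le_nhds
  have hlim2 : Tendsto (fun η : ℝ => (1 + η) * S + (η ^ 2 + η)) (𝓝[>] 0) (𝓝 S) := by
    have : Continuous fun η : ℝ => (1 + η) * S + (η ^ 2 + η) := by fun_prop
    simpa using (this.tendsto 0).mono_left nhdsWithin_le_nhds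
  refine le_of_tendsto_of_tendsto hlim1 hlim2 (eventually_nhdsWithin_of_forall fun η hη => ?_)
  have hη : 0 < η := hη
  have e : (1 + η⁻¹) * η ^ 2 = η ^ 2 + η := by field_simp
  simp only [← e]
  exact key η hη

/-- Pointwise Fourier inversion for the continuous representative of an `L²` function with
integrable `L²` Fourier transform: both sides agree as tempered distributions. -/
theorem continuous_eq_fourierInv {f : ℝ → ℂ} (hf : Continuous f) (hf2 : MemLp f 2 volume)
    {g : ℝ → ℂ} (hg : Integrable g volume)
    (hfg : (𝓕 (hf2.toLp f) : Lp ℂ 2 (volume : Measure ℝ)) =ᵐ[volume] g) (x : ℝ) :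
    f x = 𝓕⁻ g x := by
  have hcont : Continuous (𝓕⁻ g) := by
    refine VectorFourier.fourierIntegral_continuous Real.continuous_fourierChar ?_ hg
    exact (innerSL ℝ : ℝ →L[ℝ] ℝ →L[ℝ] ℝ).continuous₂.neg
  have hae : f =ᵐ[volume] 𝓕⁻ g := by
    refine ae_eq_of_integral_contDiff_smul_eq hf.locallyIntegrable hcont.locallyIntegrable
      fun φ hφ hφc => ?_
    set ψ : SchwartzMap ℝ ℂ := HasCompactSupport.toSchwartzMap (f := fun x => (φ x : ℂ))
      (hφc.comp_left Complex.ofReal_zero) (Complex.ofRealCLM.contDiff.comp hφ) with hψ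
    have h1 : Lp.toTemperedDistribution (𝓕⁻ (𝓕 (hf2.toLp f))) ψ =
        Lp.toTemperedDistribution (𝓕 (hf2.toLp f)) (𝓕⁻ ψ) := by
      rw [← Lp.fourierInv_toTemperedDistribution_eq, TemperedDistribution.fourierInv_apply]
    rw [FourierTransform.fourierInv_fourier_eq, Lp.toTemperedDistribution_apply,
      Lp.toTemperedDistribution_apply] at h1
    have h2 : ∫ x, ψ x • (hf2.toLp f) x = ∫ x, φ x • f x := by
      refine integral_congr_ae ?_
      filter_upwards [hf2.coeFn_toLp] with x hx
      rw [hx]; rfl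
    have h3 : ∫ x, (𝓕⁻ ψ) x • (𝓕 (hf2.toLp f) : Lp ℂ 2 (volume : Measure ℝ)) x =
        ∫ x, (𝓕⁻ ψ) x • g x := by
      refine integral_congr_ae ?_
      filter_upwards [hfg] with x hx
      rw [hx]
    rw [← h2, h1, h3]
    have := VectorFourier.integral_fourierIntegral_smul_eq_flip (μ := (volume : Measure ℝ))
      (ν := (volume : Measure ℝ)) (L := -innerₗ ℝ) (e := Real.fourierChar)
      Real.continuous_fourierChar
      ((innerSL ℝ : ℝ →L[ℝ] ℝ →L[ℝ] ℝ).continuous₂.neg) (ψ.integrable) hg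
    have hflip : (-innerₗ ℝ : ℝ →ₗ[ℝ] ℝ →ₗ[ℝ] ℝ).flip = -innerₗ ℝ := by
      ext; simp
    rw [hflip] at this
    rw [SchwartzMap.fourierInv_coe]
    exact this
  exact congrFun (Continuous.ae_eq_iff_eq volume hf hcont |>.1 hae) x

/-! ### Periodic sampling sets for unions of grid intervals -/

/-- The rows of the unitary discrete Fourier matrix of size `m`, restricted to the columns in `A`,
are a Parseval frame. -/
theorem sum_vecMulVec_fourier {m : ℕ} [NeZero m] (A : Finset (Fin m)) :
    ∑ j : Fin m, Matrix.vecMulVec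
      (fun s : A => ((√m : ℝ) : ℂ)⁻¹ * Complex.exp (-(2 * Real.pi * Complex.I * j * (s.1 / m))))
      (star fun s : A => ((√m : ℝ) : ℂ)⁻¹ *
        Complex.exp (-(2 * Real.pi * Complex.I * j * (s.1 / m)))) = 1 := by
  have hm : (m : ℂ) ≠ 0 := by exact_mod_cast NeZero.ne m
  ext s t
  rw [Matrix.sum_apply]
  set z : ℂ := Complex.exp (2 * Real.pi * Complex.I * ((t.1 : ℂ) - s.1) / m) with hz
  have hterm : ∀ j : Fin m, Matrix.vecMulVec
      (fun s : A => ((√m : ℝ) : ℂ)⁻¹ * Complex.exp (-(2 * Real.pi * Complex.I * j * (s.1 / m))))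
      (star fun s : A => ((√m : ℝ) : ℂ)⁻¹ *
        Complex.exp (-(2 * Real.pi * Complex.I * j * (s.1 / m)))) s t =
      (m : ℂ)⁻¹ * z ^ (j : ℕ) := by
    intro j
    have hsq : ((√m : ℝ) : ℂ)⁻¹ * ((√m : ℝ) : ℂ)⁻¹ = (m : ℂ)⁻¹ := by
      rw [← mul_inv, ← Complex.ofReal_mul, Real.mul_self_sqrt (by positivity)]; simp
    rw [Matrix.vecMulVec_apply, Pi.star_apply, hz, ← Complex.exp_nat_mul, ← hsq]
    simp only [RCLike.star_def, map_mul, map_inv₀, Complex.conj_ofReal, ← Complex.exp_conj]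
    rw [mul_mul_mul_comm, ← Complex.exp_add]
    congr 2
    simp only [map_neg, map_mul, map_div₀, Complex.conj_I, Complex.conj_ofReal, map_ofNat,
      map_natCast]
    ring
  simp only [hterm, ← Finset.mul_sum]
  rw [Fin.sum_univ_eq_sum_range (fun j => z ^ j) m]
  by_cases hst : s = t
  · subst hst
    have : z = 1 := by rw [hz]; simp
    simp [this, hm]
  · rw [Matrix.one_apply_ne hst]
    have hz1 : z ≠ 1 := by
      rw [hz, Ne, Complex.exp_eq_one_iff]
      rintro ⟨n, hn⟩
      have hπ : (2 * Real.pi * Complex.I : ℂ) ≠ 0 := Complex.two_pi_I_ne_zero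
      have h2 : ((t.1 : ℂ) - s.1) = n * m := by
        field_simp at hn
        have : (2 * Real.pi * Complex.I : ℂ) * ((t.1 : ℂ) - s.1) =
            (2 * Real.pi * Complex.I : ℂ) * (n * m) := by
          linear_combination (2 * Real.pi * Complex.I : ℂ) * hn
        exact mul_left_cancel₀ hπ this
      have h3 : ((t.1 : ℕ) : ℤ) - (s.1 : ℕ) = n * m := by exact_mod_cast h2
      have h4 := t.1.isLt
      have h5 := s.1.isLt
      have hn0 : n = 0 := by
        by_contra hne
        rcases lt_or_gt_of_ne hne with h | h
        · have : n * (m : ℤ) ≤ -1 * m := by gcongr; omega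
          omega
        · have : 1 * (m : ℤ) ≤ n * m := by gcongr; omega
          omega
      rw [hn0] at h3
      exact hst (Subtype.ext (Fin.ext (by omega)))
    have hzm : z ^ m = 1 := by
      rw [hz, ← Complex.exp_nat_mul, Complex.exp_eq_one_iff]
      refine ⟨((t.1 : ℕ) : ℤ) - (s.1 : ℕ), ?_⟩
      push_cast
      field_simp
    rw [geom_sum_eq hz1, hzm]
    simp

theorem intervalIntegral_eq_sum_translates {F : Type*} [NormedAddCommGroup F] [NormedSpace ℝ F]
    (m : ℕ) [NeZero m] {f : ℝ → F} (hf : Integrable f volume) :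
    ∫ ξ in (0 : ℝ)..1, f ξ = ∫ u in (0 : ℝ)..1 / m, ∑ s : Fin m, f (u + s / m) := by
  have hm : (m : ℝ) ≠ 0 := by exact_mod_cast NeZero.ne m
  rw [intervalIntegral.integral_finsetSum fun s _ => (hf.comp_add_right _).intervalIntegrable]
  rw [Fin.sum_univ_eq_sum_range (fun s => ∫ u in (0 : ℝ)..1 / m, f (u + (s : ℕ) / m)) m]
  have h := intervalIntegral.sum_integral_adjacent_intervals (f := f) (μ := volume)
    (a := fun k : ℕ => (k : ℝ) / m) (n := m) fun k _ => hf.intervalIntegrable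
  rw [Nat.cast_zero, zero_div, div_self hm] at h
  rw [← h]
  refine Finset.sum_congr rfl fun s _ => ?_
  rw [intervalIntegral.integral_comp_add_right]
  congr 1
  · simp
  · push_cast; ring

/-- The union of the grid intervals `(s / m, (s + 1) / m]` with `s ∈ A`. -/
def gridSet (m : ℕ) (A : Finset (Fin m)) : Set ℝ :=
  ⋃ s ∈ A, Set.Ioc ((s : ℝ) / m) (((s : ℝ) + 1) / m)

theorem mem_gridSet_iff {m : ℕ} [NeZero m] {A : Finset (Fin m)} {u : ℝ}
    (hu : u ∈ Set.Ioc (0 : ℝ) (1 / m)) (s : Fin m) : u + s / m ∈ gridSet m A ↔ s ∈ A := by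
  have hm : (0 : ℝ) < m := by exact_mod_cast NeZero.pos m
  obtain ⟨hu0, hu1⟩ := hu
  simp only [gridSet, Set.mem_iUnion, Set.mem_Ioc, exists_prop]
  rw [le_div_iff₀ hm] at hu1
  constructor
  · rintro ⟨t, ht, h1, h2⟩
    have h1' : (t : ℝ) < u * m + s := by
      rw [div_lt_iff₀ hm, add_mul, div_mul_cancel₀ _ hm.ne'] at h1; exact h1
    have h2' : u * m + s ≤ (t : ℝ) + 1 := by
      rw [le_div_iff₀ hm, add_mul, div_mul_cancel₀ _ hm.ne'] at h2; exact h2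
    have hum : 0 < u * m := by positivity
    have e1 : ((t : ℕ) : ℝ) < (s : ℕ) + 1 := by linarith
    have e2 : ((s : ℕ) : ℝ) < (t : ℕ) + 1 := by linarith
    have e1' : (t : ℕ) < s + 1 := by exact_mod_cast e1
    have e2' : (s : ℕ) < t + 1 := by exact_mod_cast e2
    have : s = t := Fin.ext (by omega)
    rwa [this]
  · intro hs
    refine ⟨s, hs, by linarith, ?_⟩
    rw [le_div_iff₀ hm, add_mul, div_mul_cancel₀ _ hm.ne']
    linarith

theorem gridSet_subset (m : ℕ) [NeZero m] (A : Finset (Fin m)) : gridSet m A ⊆ Set.Ioc 0 1 := by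
  have hm : (0 : ℝ) < m := by exact_mod_cast NeZero.pos m
  refine Set.iUnion₂_subset fun s _ ξ hξ => ⟨lt_of_le_of_lt (by positivity) hξ.1,
    hξ.2.trans ?_⟩
  rw [div_le_one hm]
  have : (s : ℕ) + 1 ≤ m := s.isLt
  exact_mod_cast this

/-- Sampling on the residue class of `j` modulo `m` is Parseval's identity on `(0, 1 / m]` for the
superposition of the `m` pieces of `g`, twisted by the `j`-th row of the Fourier matrix. -/
theorem hasSum_sample_residue (m : ℕ) [NeZero m] {g : ℝ → ℂ} (hg : MemLp g 2 volume)
    (hsupp : ∀ ξ ∉ Set.Ioc (0 : ℝ) 1, g ξ = 0) (j : Fin m) :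
    HasSum (fun q : ℤ => ‖sample g (q * m + (j : ℕ))‖ ^ 2)
      (∫ u in (0 : ℝ)..1 / m, (m : ℝ)⁻¹ *
        ‖∑ s : Fin m, Complex.exp (2 * Real.pi * Complex.I * j * (s / m)) *
          g (u + s / m)‖ ^ 2) := by
  have hm : (0 : ℝ) < m := by exact_mod_cast NeZero.pos m
  have hmC : (m : ℂ) ≠ 0 := by exact_mod_cast NeZero.ne m
  have h01 : (0 : ℝ) < 1 / m := by positivity
  set h : ℝ → ℂ := fun u => Complex.exp (2 * Real.pi * Complex.I * j * u) *
    ∑ s : Fin m, Complex.exp (2 * Real.pi * Complex.I * j * (s / m)) * g (u + s / m) with hh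
  have hnorm : ∀ u : ℝ, ‖Complex.exp (2 * Real.pi * Complex.I * j * u)‖ = 1 := fun u => by
    rw [show (2 * Real.pi * Complex.I * j * u : ℂ) = ((2 * Real.pi * j * u : ℝ) : ℂ) * Complex.I by
      push_cast; ring, Complex.norm_exp_ofReal_mul_I]
  have hsum : MemLp (fun u : ℝ => ∑ s : Fin m,
      Complex.exp (2 * Real.pi * Complex.I * j * (s / m)) * g (u + s / m)) 2 volume :=
    memLp_finsetSum _ fun s _ =>
      (hg.comp_measurePreserving (measurePreserving_add_right volume ((s : ℝ) / m))).const_mul _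
  have hmem : MemLp h 2 volume := by
    refine hsum.of_le (Continuous.aestronglyMeasurable (by fun_prop) |>.mul hsum.1)
      (ae_of_all _ fun u => ?_)
    rw [hh]; simp only; rw [norm_mul, hnorm, one_mul]
  have hP := hasSum_sq_fourierCoeffOn h01 (hmem.restrict (Set.Ioc 0 (1 / (m : ℝ))))
  rw [← (Equiv.neg ℤ).hasSum_iff] at hP
  have hgi : Integrable g volume := by
    have : (Set.Ioc (0 : ℝ) 1).indicator g = g := by
      ext ξ
      by_cases hξ : ξ ∈ Set.Ioc (0 : ℝ) 1
      · simp [hξ]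
      · simp [hξ, hsupp ξ hξ]
    rw [← this, integrable_indicator_iff measurableSet_Ioc]
    exact (hg.restrict _).integrable (by norm_num)
  have hcoef : ∀ q : ℤ, fourierCoeffOn h01 h (-q) = m * sample g (q * m + (j : ℕ)) := by
    intro q
    have hint : Integrable (fun ξ : ℝ =>
        Complex.exp (2 * Real.pi * Complex.I * (q * m + (j : ℕ) : ℤ) * ξ) * g ξ) volume := by
      refine hgi.mono (Continuous.aestronglyMeasurable (by fun_prop) |>.mul hgi.1)
        (ae_of_all _ fun ξ => le_of_eq ?_)
      rw [norm_mul, show (2 * Real.pi * Complex.I * (q * m + (j : ℕ) : ℤ) * ξ : ℂ) =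
        ((2 * Real.pi * (q * m + (j : ℕ) : ℤ) * ξ : ℝ) : ℂ) * Complex.I by push_cast; ring,
        Complex.norm_exp_ofReal_mul_I, one_mul]
    rw [fourierCoeffOn_eq_integral, sample, intervalIntegral_eq_sum_translates m hint]
    simp only [neg_neg, fourier_coe_apply, sub_zero, one_div_one_div, smul_eq_mul,
      Complex.real_smul, Complex.ofReal_natCast]
    congr 1
    refine intervalIntegral.integral_congr fun u _ => ?_
    simp only [hh]
    rw [Finset.mul_sum, Finset.mul_sum]
    refine Finset.sum_congr rfl fun s _ => ?_
    rw [← mul_assoc, ← mul_assoc, ← Complex.exp_add, ← Complex.exp_add]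
    congr 1
    -- the two exponents differ by an integral multiple of `2πi`
    rw [Complex.exp_eq_exp_iff_exists_int]
    refine ⟨-(q * (s : ℕ)), ?_⟩
    push_cast
    field_simp
    ring
  have hP' := hP.mul_left ((m : ℝ)⁻¹ ^ 2)
  convert! hP' using 1
  · ext q
    simp only [Function.comp, Equiv.neg_apply]
    rw [hcoef, norm_mul, Complex.norm_natCast, mul_pow, ← mul_assoc, ← mul_pow,
      inv_mul_cancel₀ hm.ne', one_pow, one_mul]
  · rw [intervalIntegral.integral_const_mul, sub_zero, one_div, inv_inv, smul_eq_mul, ← mul_assoc]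
    congr 1
    · field_simp
    · refine intervalIntegral.integral_congr fun u _ => ?_
      simp only [hh]
      rw [norm_mul, hnorm, one_mul]

theorem exists_periodic_isSampling (m : ℕ) [NeZero m] (A : Finset (Fin m)) (hA : A.Nonempty)
    (e : ℝ) (he : 0 < e) (he1 : e ≤ 1) (N : ℕ) (hN : (1 + e) * A.card ≤ N) :
    ∃ J : Finset (Fin m), J.card ≤ N ∧ IsSampling (e ^ 2 / 16 * (A.card / m)) (gridSet m A)
      fun n => decide ((Int.divModEquiv m n).2 ∈ J) := by
  classical
  have hm : (0 : ℝ) < m := by exact_mod_cast NeZero.pos m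
  have : Nonempty A := hA.to_subtype
  obtain ⟨J, hJ, hbound⟩ := exists_subset_frame_lower_bound _ (sum_vecMulVec_fourier A)
    (by simpa using Finset.card_le_univ A) e he he1 N (by simpa using hN)
  simp only [Fintype.card_coe, Fintype.card_fin] at hbound
  refine ⟨J, hJ, fun g hg hsupp => ?_⟩
  set C := e ^ 2 / 16 * (A.card / m : ℝ) with hC
  have hsupp' : ∀ ξ ∉ Set.Ioc (0 : ℝ) 1, g ξ = 0 := fun ξ hξ =>
    hsupp ξ fun h => hξ (gridSet_subset m A h)
  have hres := hasSum_sample_residue m hg hsupp'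
  set B : Fin m → ℝ → ℝ := fun j u => (m : ℝ)⁻¹ *
    ‖∑ s : Fin m, Complex.exp (2 * Real.pi * Complex.I * j * (s / m)) * g (u + s / m)‖ ^ 2 with hB
  have hBint : ∀ j, IntervalIntegrable (B j) volume 0 (1 / m) := fun j => by
    have : MemLp (fun u : ℝ => ∑ s : Fin m,
        Complex.exp (2 * Real.pi * Complex.I * j * (s / m)) * g (u + s / m)) 2 volume :=
      memLp_finsetSum _ fun s _ =>
        (hg.comp_measurePreserving (measurePreserving_add_right volume ((s : ℝ) / m))).const_mul _
    exact ((this.integrable_norm_pow (by norm_num)).const_mul _).intervalIntegrable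
  have hgi : Integrable (fun ξ => ‖g ξ‖ ^ 2) volume := hg.integrable_norm_pow (by norm_num)
  have hsplit : ∫ ξ, ‖g ξ‖ ^ 2 = ∫ u in (0 : ℝ)..1 / m, ∑ s : Fin m, ‖g (u + s / m)‖ ^ 2 := by
    rw [← intervalIntegral_eq_sum_translates m hgi, intervalIntegral.integral_of_le zero_le_one,
      setIntegral_eq_integral_of_forall_compl_eq_zero]
    intro ξ hξ; simp [hsupp' ξ hξ]
  have hsum : (∑' n : ℤ, if decide ((Int.divModEquiv m n).2 ∈ J) = true then
      ‖sample g n‖ ^ 2 else 0) = ∑ j ∈ J, ∫ u in (0 : ℝ)..1 / m, B j u := by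
    have hs := summable_ite_sample hg hsupp' fun n => decide ((Int.divModEquiv m n).2 ∈ J)
    rw [← ((Equiv.prodComm _ _).trans (Int.divModEquiv m).symm).summable_iff] at hs
    rw [← ((Equiv.prodComm _ _).trans (Int.divModEquiv m).symm).tsum_eq]
    refine (hs.tsum_prod).trans ?_
    rw [tsum_fintype, ← Finset.sum_subset (Finset.subset_univ J)]
    · refine Finset.sum_congr rfl fun j hj => ?_
      rw [← (hres j).tsum_eq]
      refine tsum_congr fun q => ?_
      simp [hj, -Int.divModEquiv_apply, -Int.divModEquiv_symm_apply]
      rw [Int.divModEquiv_symm_apply]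
    · intro j _ hj
      rw [← tsum_zero (β := ℤ)]
      refine tsum_congr fun q => ?_
      simp [hj, -Int.divModEquiv_apply, -Int.divModEquiv_symm_apply]
  rw [hsum, hsplit, ← intervalIntegral.integral_const_mul,
    ← intervalIntegral.integral_finsetSum fun j _ => hBint j]
  refine intervalIntegral.integral_mono_on_of_le_Ioo (by positivity) ?_ ?_ fun u hu => ?_
  · refine IntervalIntegrable.const_mul ?_ _
    exact (integrable_finsetSum _ fun s _ => hgi.comp_add_right _).intervalIntegrable
  · simpa only [Finset.sum_fn] using IntervalIntegrable.sum J fun j _ => hBint j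
  · have hu' : u ∈ Set.Ioc (0 : ℝ) (1 / m) := ⟨hu.1, hu.2.le⟩
    have hz : ∀ s ∉ A, g (u + s / m) = 0 := fun s hs =>
      hsupp _ fun h => hs ((mem_gridSet_iff hu' s).1 h)
    have h1 := hbound fun s => g (u + s.1 / m)
    have h2 : ∑ s : Fin m, ‖g (u + s / m)‖ ^ 2 = ∑ s : A, ‖g (u + s.1 / m)‖ ^ 2 := by
      rw [Finset.sum_coe_sort A fun s => ‖g (u + s / m)‖ ^ 2]
      exact (Finset.sum_subset (Finset.subset_univ A) fun s _ hs => by simp [hz s hs]).symm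
    rw [h2]
    refine h1.trans (le_of_eq (Finset.sum_congr rfl fun j _ => ?_))
    have h3 : ∑ s : Fin m, Complex.exp (2 * Real.pi * Complex.I * j * (s / m)) * g (u + s / m) =
        ∑ s : A, Complex.exp (2 * Real.pi * Complex.I * j * (s.1 / m)) * g (u + s.1 / m) := by
      rw [Finset.sum_coe_sort A fun s =>
        Complex.exp (2 * Real.pi * Complex.I * j * (s / m)) * g (u + s / m)]
      exact (Finset.sum_subset (Finset.subset_univ A) fun s _ hs => by simp [hz s hs]).symm
    have h4 : (star fun s : A => ((√m : ℝ) : ℂ)⁻¹ *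
        Complex.exp (-(2 * Real.pi * Complex.I * j * (s.1 / m)))) ⬝ᵥ
          (fun s : A => g (u + s.1 / m)) =
        ((√m : ℝ) : ℂ)⁻¹ * ∑ s : A, Complex.exp (2 * Real.pi * Complex.I * j * (s.1 / m)) *
          g (u + s.1 / m) := by
      rw [dotProduct, Finset.mul_sum]
      refine Finset.sum_congr rfl fun s _ => ?_
      rw [Pi.star_apply]
      simp only [RCLike.star_def, map_mul, map_inv₀, Complex.conj_ofReal, ← Complex.exp_conj,
        map_neg, map_div₀, Complex.conj_I, map_ofNat, map_natCast]
      rw [mul_assoc]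
      congr 3
      ring
    simp only [hB]
    rw [h4, h3, norm_mul, mul_pow, norm_inv, Complex.norm_real, Real.norm_of_nonneg (by positivity),
      inv_pow, Real.sq_sqrt (by positivity)]

/-! ### Sampling sets for measurable spectra -/

/-- A window of length `T` meets an `m`-periodic set with `|J|` elements per period in `T |J| / m`
elements, on average over the translates. -/
theorem sum_windowCount_periodic (m : ℕ) [NeZero m] (J : Finset (Fin m)) (T : ℕ) :
    ∑ t : Fin m, windowCount (fun n => decide ((Int.divModEquiv m n).2 ∈ J)) (t : ℕ) T =
      T * J.card := by
  classical
  induction T with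
  | zero => simp [windowCount]
  | succ T ih =>
    simp only [windowCount_add, Finset.sum_add_distrib, ih]
    rw [add_mul, one_mul]
    congr 1
    set σ : Fin m → Fin m := fun t => (Int.divModEquiv m ((t : ℕ) + (T : ℤ))).2 with hσ
    have hinj : Function.Injective σ := by
      intro a b hab
      have h : ∀ n : ℤ, (Int.divModEquiv m n).1 * m + ((Int.divModEquiv m n).2 : ℕ) = n := by
        intro n
        rw [← Int.divModEquiv_symm_apply, Equiv.symm_apply_apply]
      have ha := h ((a : ℕ) + T)
      have hb := h ((b : ℕ) + T)
      have hab' : (Int.divModEquiv m ((a : ℕ) + (T : ℤ))).2 =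
        (Int.divModEquiv m ((b : ℕ) + (T : ℤ))).2 := hab
      rw [hab'] at ha
      have hmod : ((a : ℕ) : ℤ) ≡ (b : ℕ) [ZMOD m] := by
        rw [Int.modEq_iff_dvd]
        refine ⟨(Int.divModEquiv m ((b : ℕ) + (T : ℤ))).1 -
          (Int.divModEquiv m ((a : ℕ) + (T : ℤ))).1, ?_⟩
        linarith
      have := Int.natCast_modEq_iff.1 hmod
      exact Fin.ext (Nat.ModEq.eq_of_lt_of_lt this a.isLt b.isLt)
    have hone : ∀ t : Fin m, windowCount (fun n => decide ((Int.divModEquiv m n).2 ∈ J))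
        ((t : ℕ) + (T : ℤ)) 1 = if σ t ∈ J then 1 else 0 := by
      intro t
      have hI : Finset.Ico ((t : ℕ) + (T : ℤ)) ((t : ℕ) + (T : ℤ) + (1 : ℕ)) =
          {((t : ℕ) + (T : ℤ))} := by
        ext i; simp only [Finset.mem_Ico, Finset.mem_singleton]; omega
      rw [windowCount, hI, Finset.filter_singleton]
      by_cases h : σ t ∈ J
      · rw [if_pos h, if_pos (by simpa only [decide_eq_true_eq] using h), Finset.card_singleton]
      · rw [if_neg h, if_neg (by simpa only [decide_eq_true_eq] using h), Finset.card_empty]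
    simp only [hone]
    exact ((Equiv.ofBijective σ (Finite.injective_iff_bijective.1 hinj)).sum_comp
      (fun j => if j ∈ J then 1 else 0)).trans (by simp)

theorem volume_gridSet (m : ℕ) [NeZero m] (A : Finset (Fin m)) :
    volume.real (gridSet m A) = A.card / m := by
  have hm : (0 : ℝ) < m := by exact_mod_cast NeZero.pos m
  rw [gridSet, measureReal_biUnion_finset (h := fun _ _ => measure_Ioc_lt_top.ne)]
  · have : ∀ s : Fin m, volume.real (Set.Ioc ((s : ℝ) / m) (((s : ℝ) + 1) / m)) = 1 / m := by
      intro s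
      rw [Real.volume_real_Ioc_of_le (by gcongr; linarith)]
      ring
    simp only [this, Finset.sum_const, nsmul_eq_mul, mul_one_div]
  · intro s _ t _ hst
    rw [Function.onFun, Set.disjoint_left]
    rintro ξ ⟨h1, h2⟩ ⟨h3, h4⟩
    rw [div_lt_iff₀ hm] at h1 h3
    rw [le_div_iff₀ hm] at h2 h4
    have e1 : ((s : ℕ) : ℝ) < (t : ℕ) + 1 := by linarith
    have e2 : ((t : ℕ) : ℝ) < (s : ℕ) + 1 := by linarith
    have e1' : (s : ℕ) < t + 1 := by exact_mod_cast e1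
    have e2' : (t : ℕ) < s + 1 := by exact_mod_cast e2
    exact hst (Fin.ext (by omega))
  · exact fun _ _ => measurableSet_Ioc

theorem exists_gridSet_between {K V : Set ℝ} (hK : IsCompact K) (hK01 : K ⊆ Set.Ioc 0 1)
    (hV : IsOpen V) (hKV : K ⊆ V) (R : ℝ) :
    ∃ (m : ℕ) (_ : NeZero m) (A : Finset (Fin m)), R ≤ m ∧ K ⊆ gridSet m A ∧ gridSet m A ⊆ V := by
  classical
  obtain ⟨δ, hδ, hδV⟩ := hK.exists_thickening_subset_open hV hKV
  obtain ⟨m, hm⟩ := exists_nat_gt (max R (1 / δ))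
  have hm0 : (0 : ℝ) < m := lt_trans (lt_of_lt_of_le (by positivity) (le_max_right _ _)) hm
  have hmδ : 1 / (m : ℝ) < δ := by
    rw [div_lt_comm₀ hm0 hδ]
    exact (le_max_right _ _).trans_lt hm
  have : NeZero m := ⟨by rintro rfl; simp at hm0⟩
  refine ⟨m, this, Finset.univ.filter fun s =>
    (K ∩ Set.Ioc ((s : ℝ) / m) (((s : ℝ) + 1) / m)).Nonempty,
    (le_max_left _ _).trans hm.le, fun ξ hξ => ?_, fun ξ hξ => ?_⟩
  · obtain ⟨h0, h1⟩ := hK01 hξ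
    have hpos : 0 < ⌈ξ * m⌉₊ := Nat.ceil_pos.2 (by positivity)
    have hle : ⌈ξ * m⌉₊ ≤ m := Nat.ceil_le.2 (by nlinarith)
    have hcell : ξ ∈ Set.Ioc (((⟨⌈ξ * m⌉₊ - 1, by omega⟩ : Fin m) : ℝ) / m)
        ((((⟨⌈ξ * m⌉₊ - 1, by omega⟩ : Fin m) : ℝ) + 1) / m) := by
      have hcast : ((⌈ξ * m⌉₊ - 1 : ℕ) : ℝ) = ⌈ξ * m⌉₊ - 1 := by
        rw [Nat.cast_sub hpos]; simp
      simp only [hcast]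
      constructor
      · rw [div_lt_iff₀ hm0]
        have := Nat.ceil_lt_add_one (a := ξ * m) (by positivity)
        linarith
      · rw [le_div_iff₀ hm0]
        have := Nat.le_ceil (ξ * m)
        linarith
    simp only [gridSet, Set.mem_iUnion]
    exact ⟨_, Finset.mem_filter.2 ⟨Finset.mem_univ _, ξ, hξ, hcell⟩, hcell⟩
  · simp only [gridSet, Set.mem_iUnion] at hξ
    obtain ⟨s, hs, h1, h2⟩ := hξ
    obtain ⟨ζ, hζK, h3, h4⟩ := (Finset.mem_filter.1 hs).2
    refine hδV (Metric.mem_thickening_iff.2 ⟨ζ, hζK, ?_⟩)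
    rw [add_div] at h2 h4
    rw [Real.dist_eq, abs_lt]
    constructor <;> linarith

/-- Sampling sets for a compact set `K`, with constants in terms of a number `μ` comparable to the
measure of `K`; later it is the measure of a larger set, so that the constants do not depend on
`K`. -/
theorem exists_isSampling_compact {K : Set ℝ} (hK : IsCompact K) (hK01 : K ⊆ Set.Ioc 0 1) {μ : ℝ}
    (hμ : 0 < μ) (hKμ : volume.real K ≤ μ) (hμK : μ / 2 ≤ volume.real K) {e : ℝ} (he : 0 < e)
    (he1 : e ≤ 1) (T : ℕ) :
    ∃ x, IsSampling (e ^ 2 / 32 * μ) K x ∧ (windowCount x 0 T : ℝ) ≤ (1 + 5 * e) * μ * T := by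
  have hKfin : volume K ≠ ⊤ := hK.measure_lt_top.ne
  obtain ⟨V, hKV, hV, hVvol⟩ := K.exists_isOpen_lt_add hKfin
    (ε := ENNReal.ofReal (e * μ)) (by simp; positivity)
  obtain ⟨m, _, A, hm, hKA, hAV⟩ := exists_gridSet_between hK hK01 hV hKV (2 / (e * μ))
  have hm0 : (0 : ℝ) < m := by exact_mod_cast NeZero.pos m
  have hVfin : volume V ≠ ⊤ := (hVvol.trans (by finiteness)).ne
  have hAvol : (A.card : ℝ) / m ≤ (1 + e) * μ := by
    rw [← volume_gridSet]
    calc volume.real (gridSet m A) ≤ volume.real V := measureReal_mono hAV hVfin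
      _ ≤ volume.real K + e * μ := by
        have := ENNReal.toReal_mono (by finiteness) hVvol.le
        rwa [ENNReal.toReal_add hKfin (by finiteness),
          ENNReal.toReal_ofReal (by positivity)] at this
      _ ≤ _ := by linarith
  have hAvol' : μ / 2 ≤ (A.card : ℝ) / m := by
    rw [← volume_gridSet]
    exact hμK.trans (measureReal_mono hKA (ne_top_of_le_ne_top hVfin (measure_mono hAV)))
  -- the grid is so fine that rounding `(1 + e) |A|` up to an integer costs at most `e |A|`
  have hAm : 1 ≤ e * A.card := by
    rw [le_div_iff₀ hm0] at hAvol'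
    rw [div_le_iff₀ (by positivity)] at hm
    nlinarith
  have hA : A.Nonempty := by
    rw [Finset.nonempty_iff_ne_empty]; rintro rfl; simp at hAm; linarith
  obtain ⟨J, hJ, hsamp⟩ := exists_periodic_isSampling m A hA e he he1 ⌈(1 + e) * A.card⌉₊
    (Nat.le_ceil _)
  have hJ' : (J.card : ℝ) ≤ (1 + 2 * e) * A.card := by
    have h1 : (J.card : ℝ) ≤ ⌈(1 + e) * A.card⌉₊ := by exact_mod_cast hJ
    have h2 := Nat.ceil_lt_add_one (a := (1 + e) * (A.card : ℝ)) (by positivity)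
    linarith
  set x₀ : ℤ → Bool := fun n => decide ((Int.divModEquiv m n).2 ∈ J) with hx₀
  -- a translate with at most the average number of elements in the window
  obtain ⟨t, -, ht⟩ : ∃ t ∈ (Finset.univ : Finset (Fin m)),
      (windowCount x₀ (t : ℕ) T : ℝ) ≤ T * J.card / m := by
    refine Finset.exists_le_of_sum_le Finset.univ_nonempty (le_of_eq ?_)
    rw [← Nat.cast_sum, sum_windowCount_periodic]
    simp
    field_simp
  refine ⟨fun n => x₀ (n + (t : ℕ)), (hsamp.mono ?_ hKA).shift _, ?_⟩
  · calc e ^ 2 / 32 * μ = e ^ 2 / 16 * (μ / 2) := by ring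
      _ ≤ _ := by gcongr
  · rw [windowCount_shift, zero_add]
    refine ht.trans ?_
    calc (T : ℝ) * J.card / m ≤ T * ((1 + 2 * e) * A.card) / m := by gcongr
      _ = T * (1 + 2 * e) * (A.card / m) := by ring
      _ ≤ T * (1 + 2 * e) * ((1 + e) * μ) := by gcongr
      _ = ((1 + 2 * e) * (1 + e)) * (μ * T) := by ring
      _ ≤ (1 + 5 * e) * (μ * T) := by gcongr; nlinarith
      _ = _ := by ring

theorem exists_isSampling_windowCount_le {E : Set ℝ} (hEm : MeasurableSet E)
    (hE : E ⊆ Set.Ioc 0 1) (hpos : 0 < volume.real E) {e : ℝ} (he : 0 < e) (he1 : e ≤ 1) (T : ℕ) :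
    ∃ x, IsSampling (e ^ 2 / 32 * volume.real E) E x ∧
      (windowCount x 0 T : ℝ) ≤ (1 + 5 * e) * volume.real E * T := by
  set μ := volume.real E with hμ
  have hEfin : volume E ≠ ⊤ := ((measure_mono hE).trans_lt (by simp)).ne
  obtain ⟨K₀, hK₀E, hK₀, hK₀vol⟩ := hEm.exists_isCompact_lt_add hEfin
    (ε := ENNReal.ofReal (μ / 2)) (by simp; positivity)
  have hK₀μ : μ / 2 ≤ volume.real K₀ := by
    have hfin : volume K₀ ≠ ⊤ := hK₀.measure_lt_top.ne
    have := ENNReal.toReal_mono (by finiteness) hK₀vol.le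
    rw [ENNReal.toReal_add hfin (by finiteness), ENNReal.toReal_ofReal (by positivity)] at this
    change μ ≤ volume.real K₀ + μ / 2 at this
    linarith
  set I := {K : Set ℝ // IsCompact K ∧ K₀ ⊆ K ∧ K ⊆ E} with hI
  have : Nonempty I := ⟨⟨K₀, hK₀, subset_rfl, hK₀E⟩⟩
  set F : I → Set (ℤ → Bool) := fun K => {x | IsSampling (e ^ 2 / 32 * μ) K.1 x} ∩
    {x | (windowCount x 0 T : ℝ) ≤ (1 + 5 * e) * μ * T} with hF
  have hclosed : ∀ K, IsClosed (F K) := fun K =>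
    (isClosed_isSampling _ (K.2.2.2.trans hE)).inter
      (isClosed_le (continuous_of_discreteTopology.comp (continuous_windowCount 0 T))
        continuous_const)
  obtain ⟨x, hx⟩ := IsCompact.nonempty_iInter_of_directed_nonempty_isCompact_isClosed F
    (fun K L => ⟨⟨K.1 ∪ L.1, K.2.1.union L.2.1, K.2.2.1.trans Set.subset_union_left,
      Set.union_subset K.2.2.2 L.2.2.2⟩,
      fun x hx => ⟨hx.1.mono le_rfl Set.subset_union_left, hx.2⟩,
      fun x hx => ⟨hx.1.mono le_rfl Set.subset_union_right, hx.2⟩⟩)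
    (fun K => exists_isSampling_compact K.2.1 (K.2.2.2.trans hE) hpos
      (measureReal_mono K.2.2.2 hEfin)
      (hK₀μ.trans (measureReal_mono K.2.2.1 K.2.1.measure_lt_top.ne)) he he1 T)
    (fun K => (hclosed K).isCompact) hclosed
  rw [Set.mem_iInter] at hx
  exact ⟨x, isSampling_of_exhaustion (by positivity) hEm hE hK₀ hK₀E
    fun K hK hK₀K hKE => (hx ⟨K, hK, hK₀K, hKE⟩).1, (hx ⟨K₀, hK₀, subset_rfl, hK₀E⟩).2⟩

theorem exists_isSampling_hasSymmetricDensity {E : Set ℝ} (hEm : MeasurableSet E)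
    (hE : E ⊆ Set.Ioc 0 1) (hpos : 0 < volume.real E) {e : ℝ} (he : 0 < e) (he1 : e ≤ 1) :
    ∃ x, IsSampling (e ^ 2 / 32 * volume.real E) E x ∧
      ∃ D ≤ (1 + 5 * e) * volume.real E, HasSymmetricDensity {n | x n = true} D := by
  obtain ⟨x, hx, D, hD, hxD⟩ := exists_mem_hasSymmetricDensity (isClosed_isSampling _ hE)
    (fun x hx t => IsSampling.shift hx t) _ (exists_isSampling_windowCount_le hEm hE hpos he he1)
  exact ⟨x, hx, D, hD, hxD⟩

/-- On the integers, a function of `PW_S` is given by the samples of its Fourier transform. -/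
theorem MemPaleyWiener.exists_sample_eq {S S' E : Set ℝ} (hS' : S' =ᵐ[volume] S)
    (hSI : S ⊆ Set.Icc 0 (2 * Real.pi)) (hEm : MeasurableSet E)
    (hE : E = (fun ξ : ℝ => 2 * Real.pi * ξ) ⁻¹' S' ∩ Set.Ioc 0 1) {f : ℝ → ℂ}
    (hf : MemPaleyWiener S f) :
    ∃ g : ℝ → ℂ, MemLp g 2 volume ∧ (∀ ξ ∉ E, g ξ = 0) ∧
      ∫ x, ‖f x‖ ^ 2 = ∫ ξ, ‖g ξ‖ ^ 2 ∧ ∀ n : ℤ, f n = sample g n := by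
  obtain ⟨hcont, hf2, hvan⟩ := hf
  have h2π : (0 : ℝ) < 2 * Real.pi := by positivity
  set G : Lp ℂ 2 (volume : Measure ℝ) := 𝓕 (hf2.toLp f) with hG
  have hqmp : Measure.QuasiMeasurePreserving (fun ξ : ℝ => 2 * Real.pi * ξ) volume volume :=
    ⟨by fun_prop, by
      rw [Real.map_volume_mul_left h2π.ne']
      exact Measure.smul_absolutelyContinuous⟩
  have hvanG : ∀ᵐ ξ ∂(volume : Measure ℝ), ξ ∉ E → G ξ = 0 := by
    have h0 : ∀ᵐ ξ : ℝ ∂volume, ξ ≠ 0 := by simp [ae_iff]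
    filter_upwards [hqmp.ae hvan, hqmp.ae hS'.mem_iff, h0] with ξ h1 h2 h3 hξ
    have hnS : 2 * Real.pi * ξ ∉ S := by
      intro hS
      apply hξ
      rw [hE]
      refine ⟨h2.2 hS, ?_⟩
      obtain ⟨a, b⟩ := hSI hS
      have ha : 0 ≤ ξ := by
        by_contra! hneg
        nlinarith
      exact ⟨lt_of_le_of_ne ha (Ne.symm h3), by nlinarith⟩
    have := h1 hnS
    rw [fourierHat, mul_div_cancel_left₀ _ h2π.ne'] at this
    refine (mul_eq_zero.1 this).resolve_left ?_
    have : (Real.pi : ℂ) ≠ 0 := by exact_mod_cast Real.pi_ne_zero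
    simp [this]
  set g : ℝ → ℂ := E.indicator G with hg
  have hgG : G =ᵐ[volume] g := by
    filter_upwards [hvanG] with ξ hξ
    by_cases h : ξ ∈ E
    · simp [hg, h]
    · simp [hg, h, hξ h]
  have hgmem : MemLp g 2 volume := (Lp.memLp G).indicator hEm
  have hE01 : E ⊆ Set.Ioc 0 1 := by rw [hE]; exact Set.inter_subset_right
  have hgsupp : ∀ ξ ∉ E, g ξ = 0 := fun ξ hξ => Set.indicator_of_notMem hξ _
  have hgint : Integrable g volume := by
    have : E.indicator g = g := by simp [hg]
    rw [← this, integrable_indicator_iff hEm]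
    have : IsFiniteMeasure (volume.restrict E) :=
      ⟨by rw [Measure.restrict_apply_univ]; exact (measure_mono hE01).trans_lt (by simp)⟩
    exact (hgmem.restrict _).integrable (by norm_num)
  refine ⟨g, hgmem, hgsupp, ?_, fun n => ?_⟩
  · have hnorm : ∀ (u : ℝ → ℂ) (w : Lp ℂ 2 (volume : Measure ℝ)), w =ᵐ[volume] u →
        ∫ x, ‖u x‖ ^ 2 = ‖w‖ ^ 2 := by
      intro u w hwu
      have h := L2.inner_def (𝕜 := ℂ) w w
      rw [inner_self_eq_norm_sq_to_K] at h
      have h2 : ∫ x, inner ℂ (w x) (w x) = ((∫ x, ‖u x‖ ^ 2 : ℝ) : ℂ) := by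
        rw [← integral_complex_ofReal]
        refine integral_congr_ae ?_
        filter_upwards [hwu] with x hx
        rw [inner_self_eq_norm_sq_to_K, hx]; simp
      rw [h2] at h
      refine Complex.ofReal_injective (h.symm.trans ?_)
      simp
    rw [hnorm f _ hf2.coeFn_toLp, hnorm g G hgG, hG, Lp.norm_fourier_eq]
  · rw [continuous_eq_fourierInv hcont hf2 hgint hgG, Real.fourierInv_eq', sample,
      intervalIntegral.integral_of_le zero_le_one, setIntegral_eq_integral_of_forall_compl_eq_zero]
    · refine integral_congr_ae (ae_of_all _ fun ξ => ?_)
      simp only [smul_eq_mul]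
      congr 2
      simp
      ring
    · intro ξ hξ
      rw [hgsupp ξ fun h => hξ (hE01 h), mul_zero]

theorem theorem2 (d : ℝ) (hd : 0 < d) :
    ∃ C : ℝ, 0 < C ∧
      ∀ S : Set ℝ, S ⊆ Set.Icc 0 (2 * Real.pi) → NullMeasurableSet S (volume : Measure ℝ) →
        0 < (volume : Measure ℝ) S →
        ∃ Λ : Set ℤ,
          (∃ D : ℝ, HasSymmetricDensity Λ D ∧ D < (1 + d) * normalizedMeasure S) ∧
          ∀ f : ℝ → ℂ, MemPaleyWiener S f →
            Summable (fun l : Λ => ‖f ((l : ℤ) : ℝ)‖ ^ 2) ∧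
            C * normalizedMeasure S * ∫ x : ℝ, ‖f x‖ ^ 2 ≤ ∑' l : Λ, ‖f ((l : ℤ) : ℝ)‖ ^ 2 := by
  set e : ℝ := min 1 (d / 10) with he
  have he0 : 0 < e := lt_min one_pos (by positivity)
  have he1 : e ≤ 1 := min_le_left _ _
  have hed : 5 * e < d := by
    have : e ≤ d / 10 := min_le_right _ _
    linarith
  refine ⟨e ^ 2 / 32, by positivity, fun S hSI hSm hSpos => ?_⟩
  have h2π : (0 : ℝ) < 2 * Real.pi := by positivity
  obtain ⟨S', hS'S, hS'm, hS'ae⟩ := hSm.exists_measurable_subset_ae_eq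
  set E : Set ℝ := (fun ξ : ℝ => 2 * Real.pi * ξ) ⁻¹' S' ∩ Set.Ioc 0 1 with hE
  have hEm : MeasurableSet E := ((by fun_prop : Measurable fun ξ : ℝ => 2 * Real.pi * ξ) hS'm).inter
    measurableSet_Ioc
  have hE01 : E ⊆ Set.Ioc 0 1 := Set.inter_subset_right
  have hEvol : volume.real E = normalizedMeasure S := by
    have hEae : E =ᵐ[volume] (fun ξ : ℝ => 2 * Real.pi * ξ) ⁻¹' S' := by
      have h0 : ∀ᵐ ξ : ℝ ∂volume, ξ ≠ 0 := by simp [ae_iff]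
      refine Filter.eventuallyEq_set.2 ?_
      filter_upwards [h0] with ξ h3
      refine ⟨fun h => h.1, fun h => ⟨h, ?_⟩⟩
      obtain ⟨a, b⟩ := hSI (hS'S h)
      have ha : 0 ≤ ξ := by
        by_contra! hneg
        nlinarith
      exact ⟨lt_of_le_of_ne ha (Ne.symm h3), by nlinarith⟩
    rw [measureReal_congr hEae, measureReal_def, Real.volume_preimage_mul_left h2π.ne',
      ENNReal.toReal_mul, normalizedMeasure, measure_congr hS'ae, ENNReal.toReal_ofReal
      (by positivity), abs_of_pos (by positivity), measureReal_def]
    ring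
  have hSfin : volume S ≠ ⊤ := ((measure_mono hSI).trans_lt measure_Icc_lt_top).ne
  have hSn : 0 < normalizedMeasure S :=
    div_pos (ENNReal.toReal_pos hSpos.ne' hSfin) h2π
  obtain ⟨x, hx, D, hD, hxD⟩ := exists_isSampling_hasSymmetricDensity hEm hE01
    (by rw [hEvol]; exact hSn) he0 he1
  rw [hEvol] at hx hD
  refine ⟨{n | x n = true}, ⟨D, hxD, hD.trans_lt ?_⟩, fun f hf => ?_⟩
  · gcongr
  · obtain ⟨g, hg2, hgsupp, hnorm, hsample⟩ := hf.exists_sample_eq hS'ae hSI hEm hE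
    have hsupp' : ∀ ξ ∉ Set.Ioc (0 : ℝ) 1, g ξ = 0 := fun ξ hξ => hgsupp ξ fun h => hξ (hE01 h)
    simp only [hsample]
    refine ⟨(hasSum_sample hg2 hsupp').summable.subtype _, ?_⟩
    rw [hnorm]
    refine (hx g hg2 hgsupp).trans (le_of_eq ?_)
    rw [tsum_subtype {n : ℤ | x n = true} fun n => ‖sample g n‖ ^ 2]
    refine tsum_congr fun n => ?_
    by_cases h : x n = true
    · rw [if_pos h, Set.indicator_of_mem (show n ∈ {n : ℤ | x n = true} from h)]
    · rw [if_neg h, Set.indicator_of_notMem (show n ∉ {n : ℤ | x n = true} from h)]
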